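/- Let $\mu,\nu$ be probability measures on $\mathbb R$ with finite first moments such that $\mu<_{cx}\nu$, i.e. $\mu\ne\nu$ and $\int f\,d\mu\le\int f\,d\nu$ in $(-\infty,+\infty]$ for every convex $f:\mathbb R\to\mathbb R$. For a probability measure $\eta$ on $\mathbb R$ let $F_\eta(x)=\eta((-\infty,x])$ and $F_\eta^{-1}(u)=\inf\{x\in\mathbb R: F_\eta(x)\ge u\}$, $u\in(0,1)$. Let $d=F_\mu^{-1}-F_\nu^{-1}$, $\Psi_\pm(u)=\int_0^u d^\pm(v)\,dv$ for $u\in[0,1]$ (where $x^+=\max(x,0)$, $x^-=\max(-x,0)$), and $\gamma=\Psi_+(1)=\Psi_-(1)\in(0,\infty)$. *The set $\mathcal Q$.* Let $\mathcal Q$ be the set of probability measures $Q$ on $(0,1)^2$ with first marginal $\frac1\gamma d^+(u)\,du$, second marginal $\frac1\gamma d^-(v)\,dv$, and $Q(\{(u,v):u<v\})=1$. *The kernels $\widetilde m^Q$.* For $Q\in\mathcal Q$ let $\pi_+^Q,\pi_-^Q$ be any sub-Markov kernels on $(0,1)$ with $Q(du,dv)=\frac1\gamma d^+(u)\,du\,\pi^Q_+(u,dv)=\frac1\gamma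 d^-(v)\,dv\,\pi^Q_-(v,du)$, such that $\pi^Q_+(u,(0,1))=1$ for a.e. $u$ with $d(u)>0$ and $\pi^Q_-(v,(0,1))=1$ for a.e. $v$ with $d(v)<0$. Let $\widetilde m^Q(u,dy)$, $u\in(0,1)$, be the Markov kernel $$\int_{(0,1)}\frac{F_\mu^{-1}(u)-F_\nu^{-1}(u)}{F_\nu^{-1}(v)-F_\nu^{-1}(u)}\,\delta_{F_\nu^{-1}(v)}(dy)\,\pi(dv)+\int_{(0,1)}\frac{F_\nu^{-1}(v)-F_\mu^{-1}(u)}{F_\nu^{-1}(v)-F_\nu^{-1}(u)}\,\pi(dv)\;\delta_{F_\nu^{-1}(u)}(dy)$$ with $\pi=\pi^Q_+(u,\cdot)$ if $d(u)>0$ and $\pi^Q_+(u,\{v:F_\nu^{-1}(v)>F_\mu^{-1}(u)\})=1$; with $\pi=\pi^Q_-(u,\cdot)$ if $d(u)<0$ and $\pi^Q_-(u,\{v:F_\nu^{-1}(v)<F_\mu^{-1}(u)\})=1$; and $\widetilde m^Q(u,dy)=\delta_{F_\nu^{-1}(u)}(dy)$ otherwise. *The cost.* For $\rho\in\mathbb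 R$ and a Markov kernel $\widetilde m$ let $$\mathcal C_\rho(\widetilde m)=\int_0^1\int_{\mathbb R}|F_\nu^{-1}(u)-y|^\rho\,\mathbf 1_{\{y\ne F_\nu^{-1}(u)\}}\,\widetilde m(u,dy)\,du\in[0,+\infty].$$ (1) Let $\varphi(u)=\inf\{r\in[0,1]:\Psi_-(r)\ge\Psi_+(u)\}$ and $Q^{IT}(du,dv)=\frac1\gamma d^+(u)\,du\,\mathbf 1_{\{0<\varphi(u)<1\}}\delta_{\varphi(u)}(dv)$. Then $Q^{IT}\in\mathcal Q$ and, writing $\widetilde m^{IT}=\widetilde m^{Q^{IT}}$ (inverse transform coupling), for every $Q\in\mathcal Q$ (and any choice of the disintegrations): - $\mathcal C_\rho(\widetilde m^{IT})\le\mathcal C_\rho(\widetilde m^Q)$ for all $\rho\in(-\infty,1]\cup[2,+\infty)$; - $\mathcal C_\rho(\widetilde m^{Q})\le\mathcal C_\rho(\widetilde m^{IT})$ for all $\rho\in[1,2]$; - $\mathcal C_\rho(\widetilde m^{IT})=\mathcal C_\rho(\widetilde m^Q)$ for $\rho\in\{1,2\}$. (2) Assume that there is $p\in(0,1)$ such that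 $u\mapsto\int_0^u d(v)\,dv$ is nondecreasing on $[0,p]$ and nonincreasing on $[p,1]$. Let $\chi_-(u)=\int_{1-u}^1d^-(v)\,dv$, $\chi_+=\Psi_+$, $\Gamma(u)=\inf\{r\in[0,1]:\chi_-(r)\ge\chi_+(u)\}$ and $Q^{NIT}(du,dv)=\frac1\gamma d^+(u)\,du\,\mathbf 1_{\{\Gamma(u)>0\}}\delta_{1-\Gamma(u)}(dv)$. Then $Q^{NIT}\in\mathcal Q$ and, writing $\widetilde m^{NIT}=\widetilde m^{Q^{NIT}}$, for every $Q\in\mathcal Q$ (and any choice of the disintegrations): - $\mathcal C_\rho(\widetilde m^{Q})\le\mathcal C_\rho(\widetilde m^{NIT})$ for all $\rho\in(-\infty,1]\cup[2,+\infty)$; - $\mathcal C_\rho(\widetilde m^{NIT})\le\mathcal C_\rho(\widetilde m^{Q})$ for all $\rho\in[1,2]$; - $\mathcal C_\rho(\widetilde m^{NIT})=\mathcal C_\rho(\widetilde m^Q)$ for $\rho\in\{1,2\}$. -/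

import Mathlib

open MeasureTheory ProbabilityTheory Set
open scoped ENNReal

noncomputable section

namespace ITMC

/-- The quantile function `F_η⁻¹(u) = inf {x | F_η(x) ≥ u}`, meant for `u ∈ (0,1)`. -/
def quantile (η : Measure ℝ) (u : ℝ) : ℝ := sInf {x : ℝ | u ≤ cdf η x}

/-- The strict convex order `μ <_cx ν` for probability measures with finite first moments.
A convex `f` is bounded below by an affine function, so its integrals exist in `(-∞, +∞]`;
the inequality between them means: if the integral against `ν` is finite, so is the one against
`μ`, and the first dominates the second. -/
def StrictConvexOrder (μ ν : Measure ℝ) : Prop :=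
  (∀ f : ℝ → ℝ, ConvexOn ℝ univ f → Integrable f ν →
    Integrable f μ ∧ ∫ x, f x ∂μ ≤ ∫ x, f x ∂ν) ∧ μ ≠ ν

/-- `(F_μ⁻¹ - F_ν⁻¹)⁺`. -/
def posDiff (μ ν : Measure ℝ) (u : ℝ) : ℝ := max (quantile μ u - quantile ν u) 0

/-- `(F_μ⁻¹ - F_ν⁻¹)⁻`. -/
def negDiff (μ ν : Measure ℝ) (u : ℝ) : ℝ := max (-(quantile μ u - quantile ν u)) 0

def PsiPlus (μ ν : Measure ℝ) (u : ℝ) : ℝ := ∫ v in (0 : ℝ)..u, posDiff μ ν v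

def PsiMinus (μ ν : Measure ℝ) (u : ℝ) : ℝ := ∫ v in (0 : ℝ)..u, negDiff μ ν v

/-- `γ = ∫₀¹ (F_μ⁻¹ - F_ν⁻¹)⁺`. -/
def gam (μ ν : Measure ℝ) : ℝ := PsiPlus μ ν 1

/-- The measure `γ⁻¹ (F_μ⁻¹ - F_ν⁻¹)⁺(u) du` on `(0,1)`. -/
def marginalPlus (μ ν : Measure ℝ) : Measure ℝ :=
  (volume.restrict (Ioo (0 : ℝ) 1)).withDensity
    fun u => ENNReal.ofReal (posDiff μ ν u / gam μ ν)

/-- The measure `γ⁻¹ (F_μ⁻¹ - F_ν⁻¹)⁻(v) dv` on `(0,1)`. -/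
def marginalMinus (μ ν : Measure ℝ) : Measure ℝ :=
  (volume.restrict (Ioo (0 : ℝ) 1)).withDensity
    fun v => ENNReal.ofReal (negDiff μ ν v / gam μ ν)

/-- The set `𝒬` of probability measures on `(0,1)²` (seen as measures on `ℝ²` carried by
`(0,1)²`) with the two prescribed marginals and carried by `{u < v}`. -/
def QSet (μ ν : Measure ℝ) : Set (Measure (ℝ × ℝ)) :=
  {Q | IsProbabilityMeasure Q ∧
    Q.map Prod.fst = marginalPlus μ ν ∧
    Q.map Prod.snd = marginalMinus μ ν ∧
    Q {z | z.1 ∈ Ioo (0 : ℝ) 1 ∧ z.2 ∈ Ioo (0 : ℝ) 1 ∧ z.1 < z.2} = 1}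

/-- A choice of sub-Markov kernels `π₊`, `π₋` disintegrating `Q` with respect to its first and its
second marginal respectively, with full mass on `(0,1)` for almost every `u ∈ (0,1)` such that
`F_μ⁻¹(u) > F_ν⁻¹(u)`, respectively `v ∈ (0,1)` such that `F_μ⁻¹(v) < F_ν⁻¹(v)`. -/
structure Disintegration (μ ν : Measure ℝ) (Q : Measure (ℝ × ℝ)) where
  piPlus : Kernel ℝ ℝ
  piMinus : Kernel ℝ ℝ
  piPlus_le : ∀ u, piPlus u univ ≤ 1
  piMinus_le : ∀ v, piMinus v univ ≤ 1
  piPlus_mass : ∀ᵐ u ∂(volume.restrict (Ioo (0 : ℝ) 1)),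
    quantile ν u < quantile μ u → piPlus u (Ioo 0 1) = 1
  piMinus_mass : ∀ᵐ v ∂(volume.restrict (Ioo (0 : ℝ) 1)),
    quantile μ v < quantile ν v → piMinus v (Ioo 0 1) = 1
  eq_plus : Q = (marginalPlus μ ν).compProd piPlus
  eq_minus : Q = ((marginalMinus μ ν).compProd piMinus).map Prod.swap

/-- The measure
`∫_{v∈(0,1)} (F_μ⁻¹(u)-F_ν⁻¹(u))/(F_ν⁻¹(v)-F_ν⁻¹(u)) δ_{F_ν⁻¹(v)}(dy) π(dv)
 + ∫_{v∈(0,1)} (F_ν⁻¹(v)-F_μ⁻¹(u))/(F_ν⁻¹(v)-F_ν⁻¹(u)) π(dv) δ_{F_ν⁻¹(u)}(dy)`. -/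
def splitMeasure (μ ν : Measure ℝ) (π : Measure ℝ) (u : ℝ) : Measure ℝ :=
  ((π.restrict (Ioo 0 1)).withDensity fun v =>
      ENNReal.ofReal ((quantile μ u - quantile ν u) / (quantile ν v - quantile ν u))).map
        (quantile ν) +
    (∫⁻ v in Ioo 0 1,
      ENNReal.ofReal ((quantile ν v - quantile μ u) / (quantile ν v - quantile ν u)) ∂π) •
        Measure.dirac (quantile ν u)

/-- The points `u ∈ (0,1)` where `F_μ⁻¹(u) > F_ν⁻¹(u)` and
`π(u, {v ∈ (0,1) | F_ν⁻¹(v) > F_μ⁻¹(u)}) = 1`. -/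
def regionPlus (μ ν : Measure ℝ) (π : Kernel ℝ ℝ) : Set ℝ :=
  {u | u ∈ Ioo (0 : ℝ) 1 ∧ quantile ν u < quantile μ u ∧
    π u {v | v ∈ Ioo (0 : ℝ) 1 ∧ quantile μ u < quantile ν v} = 1}

/-- The points `u ∈ (0,1)` where `F_μ⁻¹(u) < F_ν⁻¹(u)` and
`π(u, {v ∈ (0,1) | F_ν⁻¹(v) < F_μ⁻¹(u)}) = 1`. -/
def regionMinus (μ ν : Measure ℝ) (π : Kernel ℝ ℝ) : Set ℝ :=
  {u | u ∈ Ioo (0 : ℝ) 1 ∧ quantile μ u < quantile ν u ∧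
    π u {v | v ∈ Ioo (0 : ℝ) 1 ∧ quantile ν v < quantile μ u} = 1}

lemma quantile_of_nonpos (η : Measure ℝ) {u : ℝ} (hu : u ≤ 0) : quantile η u = 0 := by
  have : {x : ℝ | u ≤ cdf η x} = univ := by
    ext x; simpa using hu.trans (cdf_nonneg η x)
  simp [quantile, this]

lemma quantile_of_one_lt (η : Measure ℝ) {u : ℝ} (hu : 1 < u) : quantile η u = 0 := by
  have : {x : ℝ | u ≤ cdf η x} = ∅ := by
    ext x; simpa using (cdf_le_one η x).trans_lt hu
  simp [quantile, this]

lemma quantile_monotoneOn (η : Measure ℝ) : MonotoneOn (quantile η) (Ioo 0 1) := by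
  intro u hu v hv huv
  refine csInf_le_csInf ?_ ?_ fun x hx => huv.trans hx
  · obtain ⟨a, ha⟩ := ((tendsto_cdf_atBot η).eventually (gt_mem_nhds hu.1)).exists
    refine ⟨a, fun x hx => ?_⟩
    by_contra! h
    exact absurd (hx.trans (monotone_cdf η h.le)) (not_le.2 ha)
  · obtain ⟨a, ha⟩ := ((tendsto_cdf_atTop η).eventually (lt_mem_nhds hv.2)).exists
    exact ⟨a, ha.le⟩

lemma measurable_quantile (η : Measure ℝ) : Measurable (quantile η) := by
  refine measurable_of_Iic fun a => ?_
  have h2 : MeasurableSet (Ioo (0 : ℝ) 1 ∩ quantile η ⁻¹' Iic a) := by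
    refine OrdConnected.measurableSet ⟨fun x hx y hy z hz => ?_⟩
    have hz' : z ∈ Ioo (0 : ℝ) 1 := ⟨hx.1.1.trans_le hz.1, hz.2.trans_lt hy.1.2⟩
    exact ⟨hz', (quantile_monotoneOn η hz' hy.1 hz.2).trans hy.2⟩
  have h3 : MeasurableSet ({1} ∩ quantile η ⁻¹' Iic a) :=
    (Set.countable_singleton (1 : ℝ)).mono inter_subset_left |>.measurableSet
  have h4 : MeasurableSet ((Iic (0 : ℝ) ∪ Ioi 1) ∩ {_u | (0 : ℝ) ≤ a}) :=
    (measurableSet_Iic.union measurableSet_Ioi).inter (MeasurableSet.const _)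
  convert (h2.union h3).union h4 using 1
  ext u
  rcases le_or_gt u 0 with h | h
  · have := quantile_of_nonpos η h
    simp [this, h, not_lt.2 h]
  rcases lt_trichotomy u 1 with h' | rfl | h'
  · simp [h, h', h.not_ge, h'.ne, h'.not_gt]
  · simp
  · have := quantile_of_one_lt η h'
    simp [this, h', h'.ne', h'.not_gt]

lemma measurableSet_regionPlus (μ ν : Measure ℝ) (π : Kernel ℝ ℝ) [IsSFiniteKernel π] :
    MeasurableSet (regionPlus μ ν π) := by
  have hμ := measurable_quantile μ
  have hν := measurable_quantile ν
  have ht : MeasurableSet {p : ℝ × ℝ | p.2 ∈ Ioo (0 : ℝ) 1 ∧ quantile μ p.1 < quantile ν p.2} :=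
    (measurable_snd measurableSet_Ioo).inter
      (measurableSet_lt (hμ.comp measurable_fst) (hν.comp measurable_snd))
  exact measurableSet_Ioo.inter ((measurableSet_lt hν hμ).inter
    (Kernel.measurable_kernel_prodMk_left (κ := π) ht (measurableSet_singleton 1)))

lemma measurableSet_regionMinus (μ ν : Measure ℝ) (π : Kernel ℝ ℝ) [IsSFiniteKernel π] :
    MeasurableSet (regionMinus μ ν π) := by
  have hμ := measurable_quantile μ
  have hν := measurable_quantile ν
  have ht : MeasurableSet {p : ℝ × ℝ | p.2 ∈ Ioo (0 : ℝ) 1 ∧ quantile ν p.2 < quantile μ p.1} :=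
    (measurable_snd measurableSet_Ioo).inter
      (measurableSet_lt (hν.comp measurable_snd) (hμ.comp measurable_fst))
  exact measurableSet_Ioo.inter ((measurableSet_lt hμ hν).inter
    (Kernel.measurable_kernel_prodMk_left (κ := π) ht (measurableSet_singleton 1)))

lemma measurable_splitMeasure (μ ν : Measure ℝ) (π : Kernel ℝ ℝ) [IsSFiniteKernel π] :
    Measurable fun u => splitMeasure μ ν (π u) u := by
  have hμ := measurable_quantile μ
  have hν := measurable_quantile ν
  have hμ1 : Measurable fun p : ℝ × ℝ => quantile μ p.1 := hμ.comp measurable_fst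
  have hν1 : Measurable fun p : ℝ × ℝ => quantile ν p.1 := hν.comp measurable_fst
  have hν2 : Measurable fun p : ℝ × ℝ => quantile ν p.2 := hν.comp measurable_snd
  refine Measure.measurable_of_measurable_coe _ fun s hs => ?_
  have hval : ∀ u, splitMeasure μ ν (π u) u s =
      (∫⁻ v, (quantile ν ⁻¹' s ∩ Ioo 0 1).indicator (fun v => ENNReal.ofReal
        ((quantile μ u - quantile ν u) / (quantile ν v - quantile ν u))) v ∂(π u)) +
      (∫⁻ v, (Ioo (0 : ℝ) 1).indicator (fun v => ENNReal.ofReal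
        ((quantile ν v - quantile μ u) / (quantile ν v - quantile ν u))) v ∂(π u)) *
        s.indicator 1 (quantile ν u) := by
    intro u
    rw [splitMeasure, Measure.add_apply, Measure.map_apply hν hs, withDensity_apply _ (hν hs),
      Measure.restrict_restrict (hν hs), Measure.smul_apply, Measure.dirac_apply' _ hs,
      lintegral_indicator ((hν hs).inter measurableSet_Ioo),
      lintegral_indicator measurableSet_Ioo, smul_eq_mul]
  simp_rw [hval]
  refine Measurable.add ?_ (Measurable.mul ?_ ?_)
  · refine Measurable.lintegral_kernel_prod_right (κ := π) ?_
    exact Measurable.indicator (s := {p : ℝ × ℝ | p.2 ∈ quantile ν ⁻¹' s ∩ Ioo 0 1})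
      (f := fun p : ℝ × ℝ => ENNReal.ofReal
        ((quantile μ p.1 - quantile ν p.1) / (quantile ν p.2 - quantile ν p.1)))
      (by fun_prop) (measurable_snd ((hν hs).inter measurableSet_Ioo))
  · refine Measurable.lintegral_kernel_prod_right (κ := π) ?_
    exact Measurable.indicator (s := {p : ℝ × ℝ | p.2 ∈ Ioo (0 : ℝ) 1})
      (f := fun p : ℝ × ℝ => ENNReal.ofReal
        ((quantile ν p.2 - quantile μ p.1) / (quantile ν p.2 - quantile ν p.1)))
      (by fun_prop) (measurable_snd measurableSet_Ioo)
  · exact (measurable_one.indicator hs).comp hν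

instance {μ ν : Measure ℝ} {Q : Measure (ℝ × ℝ)} (D : Disintegration μ ν Q) :
    IsFiniteKernel D.piPlus := ⟨1, ENNReal.one_lt_top, D.piPlus_le⟩

instance {μ ν : Measure ℝ} {Q : Measure (ℝ × ℝ)} (D : Disintegration μ ν Q) :
    IsFiniteKernel D.piMinus := ⟨1, ENNReal.one_lt_top, D.piMinus_le⟩

open Classical in
/-- The Markov kernel `m̃^Q(u, dy)` attached to (a disintegration of) `Q`. Only `u ∈ (0,1)`
matters; outside `(0,1)` the last case applies. -/
def tildeKernel {μ ν : Measure ℝ} {Q : Measure (ℝ × ℝ)} (D : Disintegration μ ν Q) :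
    Kernel ℝ ℝ where
  toFun u :=
    if u ∈ regionPlus μ ν D.piPlus then splitMeasure μ ν (D.piPlus u) u
    else if u ∈ regionMinus μ ν D.piMinus then splitMeasure μ ν (D.piMinus u) u
    else Measure.dirac (quantile ν u)
  measurable' :=
    Measurable.ite (measurableSet_regionPlus μ ν D.piPlus) (measurable_splitMeasure μ ν D.piPlus)
      (Measurable.ite (measurableSet_regionMinus μ ν D.piMinus)
        (measurable_splitMeasure μ ν D.piMinus)
        (Measure.measurable_dirac.comp (measurable_quantile ν)))

lemma splitMeasure_univ {μ ν π : Measure ℝ} {u : ℝ} (hπ : π univ ≤ 1)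
    (h : (quantile ν u < quantile μ u ∧
        π {v | v ∈ Ioo (0 : ℝ) 1 ∧ quantile μ u < quantile ν v} = 1) ∨
      (quantile μ u < quantile ν u ∧
        π {v | v ∈ Ioo (0 : ℝ) 1 ∧ quantile ν v < quantile μ u} = 1)) :
    splitMeasure μ ν π u univ = 1 := by
  have hν := measurable_quantile ν
  have : IsFiniteMeasure π := ⟨hπ.trans_lt ENNReal.one_lt_top⟩
  have key : ∀ A : Set ℝ, MeasurableSet A → A ⊆ Ioo 0 1 → π A = 1 →
      (∀ v ∈ A, 0 ≤ (quantile μ u - quantile ν u) / (quantile ν v - quantile ν u) ∧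
        0 ≤ (quantile ν v - quantile μ u) / (quantile ν v - quantile ν u) ∧
        quantile ν v - quantile ν u ≠ 0) → splitMeasure μ ν π u univ = 1 := by
    intro A hA hsub hA1 hr
    have hAc : π Aᶜ = 0 := by
      rw [measure_compl hA (measure_ne_top _ _), hA1]
      exact tsub_eq_zero_of_le hπ
    have hae : ∀ᵐ v ∂π, v ∈ A := hAc
    have hres : π.restrict (Ioo 0 1) = π :=
      Measure.restrict_eq_self_of_ae_mem (hae.mono fun v hv => hsub hv)
    have hm : Measurable fun v => ENNReal.ofReal
        ((quantile μ u - quantile ν u) / (quantile ν v - quantile ν u)) := by fun_prop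
    rw [splitMeasure, hres, Measure.add_apply, Measure.map_apply hν MeasurableSet.univ,
      preimage_univ, withDensity_apply _ MeasurableSet.univ, Measure.restrict_univ,
      Measure.smul_apply, Measure.dirac_apply_of_mem (mem_univ _), smul_eq_mul, mul_one,
      ← lintegral_add_left hm]
    have hone : ∀ᵐ v ∂π, ENNReal.ofReal
        ((quantile μ u - quantile ν u) / (quantile ν v - quantile ν u)) + ENNReal.ofReal
        ((quantile ν v - quantile μ u) / (quantile ν v - quantile ν u)) = 1 := by
      filter_upwards [hae] with v hv
      obtain ⟨h1, h2, h3⟩ := hr v hv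
      rw [← ENNReal.ofReal_add h1 h2, ← add_div, sub_add_sub_cancel', div_self h3,
        ENNReal.ofReal_one]
    rw [lintegral_congr_ae hone, lintegral_one]
    exact le_antisymm hπ (hA1 ▸ measure_mono (subset_univ A))
  rcases h with ⟨h1, h2⟩ | ⟨h1, h2⟩
  · refine key _ (measurableSet_Ioo.inter (measurableSet_lt measurable_const hν))
      (fun v hv => hv.1) h2 fun v hv => ?_
    have hv2 : quantile μ u < quantile ν v := hv.2
    exact ⟨div_nonneg (by linarith) (by linarith), div_nonneg (by linarith) (by linarith),
      by linarith⟩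
  · refine key _ (measurableSet_Ioo.inter (measurableSet_lt hν measurable_const))
      (fun v hv => hv.1) h2 fun v hv => ?_
    have hv2 : quantile ν v < quantile μ u := hv.2
    exact ⟨div_nonneg_of_nonpos (by linarith) (by linarith),
      div_nonneg_of_nonpos (by linarith) (by linarith), by linarith⟩

instance {μ ν : Measure ℝ} {Q : Measure (ℝ × ℝ)} (D : Disintegration μ ν Q) :
    IsMarkovKernel (tildeKernel D) := by
  classical
  refine ⟨fun u => ⟨?_⟩⟩
  change (if u ∈ regionPlus μ ν D.piPlus then splitMeasure μ ν (D.piPlus u) u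
    else if u ∈ regionMinus μ ν D.piMinus then splitMeasure μ ν (D.piMinus u) u
    else Measure.dirac (quantile ν u)) univ = 1
  split_ifs with h h'
  · exact splitMeasure_univ (D.piPlus_le u) (Or.inl h.2)
  · exact splitMeasure_univ (D.piMinus_le u) (Or.inr h'.2)
  · simp

/-- Every `Q ∈ 𝒬` has a disintegration. -/
lemma nonempty_disintegration {μ ν : Measure ℝ} {Q : Measure (ℝ × ℝ)} (hQ : Q ∈ QSet μ ν) :
    Nonempty (Disintegration μ ν Q) := by
  obtain ⟨hprob, h1, h2, h3⟩ := hQ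
  have hμ := measurable_quantile μ
  have hν := measurable_quantile ν
  have hS : MeasurableSet {z : ℝ × ℝ | z.1 ∈ Ioo (0 : ℝ) 1 ∧ z.2 ∈ Ioo (0 : ℝ) 1 ∧ z.1 < z.2} :=
    (measurable_fst measurableSet_Ioo).inter
      ((measurable_snd measurableSet_Ioo).inter (measurableSet_lt measurable_fst measurable_snd))
  have hae : ∀ᵐ z ∂Q, z.1 ∈ Ioo (0 : ℝ) 1 ∧ z.2 ∈ Ioo (0 : ℝ) 1 ∧ z.1 < z.2 :=
    (prob_compl_eq_zero_iff hS).2 h3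
  have hgam0 : 0 ≤ gam μ ν :=
    intervalIntegral.integral_nonneg zero_le_one fun u _ => le_max_right _ _
  have hgam : 0 < gam μ ν := by
    refine lt_of_le_of_ne hgam0 fun h0 => ?_
    have hz : Q.map Prod.fst = 0 := by simp [h1, marginalPlus, ← h0]
    have := congrArg (fun m => m univ) hz
    simp [Measure.map_apply measurable_fst MeasurableSet.univ] at this
  have mass : ∀ (P : Measure (ℝ × ℝ)) [IsProbabilityMeasure P] (f : ℝ → ℝ), Measurable f →
      P.fst = (volume.restrict (Ioo (0 : ℝ) 1)).withDensity
        (fun u => ENNReal.ofReal (f u / gam μ ν)) →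
      (∀ᵐ z ∂P, z.2 ∈ Ioo (0 : ℝ) 1) →
      ∀ᵐ u ∂(volume.restrict (Ioo (0 : ℝ) 1)), 0 < f u → P.condKernel u (Ioo 0 1) = 1 := by
    intro P _ f hf hP hP2
    rw [← P.disintegrate P.condKernel] at hP2
    have h4 := Measure.ae_ae_of_ae_compProd hP2
    rw [hP, ae_withDensity_iff (by fun_prop)] at h4
    filter_upwards [h4] with u hu hfu
    refine (prob_compl_eq_zero_iff measurableSet_Ioo).1 (hu ?_)
    simpa using div_pos hfu hgam
  have hsw : IsProbabilityMeasure (Q.map Prod.swap) :=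
    Measure.isProbabilityMeasure_map measurable_swap.aemeasurable
  have hfst : (Q.map Prod.swap).fst = marginalMinus μ ν := by
    rw [← h2, Measure.fst_map_swap]; rfl
  have hp : Measurable (posDiff μ ν) := (hμ.sub hν).max measurable_const
  have hm : Measurable (negDiff μ ν) := (hμ.sub hν).neg.max measurable_const
  refine ⟨⟨Q.condKernel, (Q.map Prod.swap).condKernel, fun u => prob_le_one,
    fun u => prob_le_one, ?_, ?_, ?_, ?_⟩⟩
  · filter_upwards [mass Q (posDiff μ ν) hp h1 (hae.mono fun z hz => hz.2.1)] with u hu h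
    exact hu (lt_max_of_lt_left (sub_pos.2 h))
  · have hsae : ∀ᵐ z ∂(Q.map Prod.swap), z.2 ∈ Ioo (0 : ℝ) 1 :=
      (ae_map_iff measurable_swap.aemeasurable (measurable_snd measurableSet_Ioo)).2
        (hae.mono fun z hz => hz.1)
    filter_upwards [mass (Q.map Prod.swap) (negDiff μ ν) hm hfst hsae] with u hu h
    exact hu (lt_max_of_lt_left (by linarith))
  · rw [← h1]; exact (Q.disintegrate Q.condKernel).symm
  · rw [← hfst, (Q.map Prod.swap).disintegrate, Measure.map_map measurable_swap measurable_swap]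
    simp

/-- `𝒞_ρ(m̃) = ∫_{(0,1)} ∫_ℝ |F_ν⁻¹(u) - y|^ρ 1_{y ≠ F_ν⁻¹(u)} m̃(u, dy) du`, in `[0, +∞]`. -/
def cost (ν : Measure ℝ) (ρ : ℝ) (m : Kernel ℝ ℝ) : ℝ≥0∞ :=
  ∫⁻ u in Ioo (0 : ℝ) 1, ∫⁻ y,
    ({y | y ≠ quantile ν u} : Set ℝ).indicator
      (fun y => ENNReal.ofReal (|quantile ν u - y| ^ ρ)) y ∂(m u)

/-- `φ(u) = Ψ₋⁻¹(Ψ₊(u)) = inf {r ∈ [0,1] | Ψ₋(r) ≥ Ψ₊(u)}`. -/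
def phi (μ ν : Measure ℝ) (u : ℝ) : ℝ :=
  sInf {r | r ∈ Icc (0 : ℝ) 1 ∧ PsiPlus μ ν u ≤ PsiMinus μ ν r}

/-- `Q^{IT}(du, dv) = γ⁻¹ (F_μ⁻¹ - F_ν⁻¹)⁺(u) du 1_{0 < φ(u) < 1} δ_{φ(u)}(dv)`. -/
def QIT (μ ν : Measure ℝ) : Measure (ℝ × ℝ) :=
  ((marginalPlus μ ν).restrict {u | 0 < phi μ ν u ∧ phi μ ν u < 1}).map fun u => (u, phi μ ν u)

/-- `χ₋(u) = ∫_{1-u}^1 (F_μ⁻¹ - F_ν⁻¹)⁻`. -/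
def chiMinus (μ ν : Measure ℝ) (u : ℝ) : ℝ := ∫ v in (1 - u)..1, negDiff μ ν v

/-- `χ₊(u) = ∫_0^u (F_μ⁻¹ - F_ν⁻¹)⁺`. -/
def chiPlus (μ ν : Measure ℝ) (u : ℝ) : ℝ := ∫ v in (0 : ℝ)..u, posDiff μ ν v

/-- `Γ(u) = χ₋⁻¹(χ₊(u)) = inf {r ∈ [0,1] | χ₋(r) ≥ χ₊(u)}`. -/
def Gam (μ ν : Measure ℝ) (u : ℝ) : ℝ :=
  sInf {r | r ∈ Icc (0 : ℝ) 1 ∧ chiPlus μ ν u ≤ chiMinus μ ν r}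

/-- `Q^{NIT}(du, dv) = γ⁻¹ (F_μ⁻¹ - F_ν⁻¹)⁺(u) du 1_{Γ(u) > 0} δ_{1 - Γ(u)}(dv)`. -/
def QNIT (μ ν : Measure ℝ) : Measure (ℝ × ℝ) :=
  ((marginalPlus μ ν).restrict {u | 0 < Gam μ ν u}).map fun u => (u, 1 - Gam μ ν u)

/-- The difference of the quantile functions changes sign only once. -/
def SingleSignChange (μ ν : Measure ℝ) : Prop :=
  ∃ p ∈ Ioo (0 : ℝ) 1,
    MonotoneOn (fun u => ∫ v in (0 : ℝ)..u, (quantile μ v - quantile ν v)) (Icc 0 p) ∧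
    AntitoneOn (fun u => ∫ v in (0 : ℝ)..u, (quantile μ v - quantile ν v)) (Icc p 1)

end ITMC

end

/-! Write G for the quantile function of ν. Integrating the two branches of the kernel shows that
the cost of `tildeKernel` depends on Q alone: it equals 2γ ∫ (G(v) - G(u))^(ρ-1) Q(du, dv), the
parts d > 0 and d < 0 contributing equally (`cost_tildeKernel`). The problem thus becomes optimal
transport between two fixed marginals, with a power cost.

Push Q forward by G in both coordinates to a law P of pairs a < b with prescribed marginals. Up to a
positive constant, (b - a)^(ρ-1) is the integral over t > 0, with weight t^(ρ-3), of (b - a - t)⁺ if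
ρ > 2, of (t - (b - a))⁺ if ρ < 1, and of min(b - a, t) if 1 < ρ < 2. Each of these is the length of
a set of s cut out by comparing a and b with s and s + t. The P-mass of the corresponding event is a
marginal minus the joint distribution function in the first two cases. In the third it is the joint
distribution function minus a marginal, because a < b. Hence a pointwise larger joint distribution
function lowers the cost outside [1, 2] and raises it inside; at ρ = 1 and ρ = 2 only the marginals
count (`QuadrantLE.lintegral_rpow_anti`, `QuadrantLE.lintegral_rpow_mono`).

It remains to see that `QIT` and `QNIT` are the Fréchet extremes of 𝒬. They are carried by a
monotone and an antitone map, so they have the largest and the smallest joint distribution function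
(`apply_prod_le_of_monotoneOn`, `apply_prod_le_of_antitoneOn`). That they charge only {u < v} comes
from the convex order, which makes u ↦ ∫₀ᵘ d nonnegative, and, for `QNIT`, from the single sign
change. -/

namespace ITMC

/-! ### Quantile functions and the Legendre duality for their primitives -/

section Quantile

/-- Right continuity of the distribution function makes the infimum attained, whence this Galois
connection. -/
lemma quantile_le_iff (η : Measure ℝ) {u : ℝ} (hu : u ∈ Ioo (0 : ℝ) 1) (x : ℝ) :
    quantile η u ≤ x ↔ u ≤ cdf η x := by
  have hbdd : BddBelow {x : ℝ | u ≤ cdf η x} := by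
    obtain ⟨a, ha⟩ := ((tendsto_cdf_atBot η).eventually (gt_mem_nhds hu.1)).exists
    refine ⟨a, fun x hx => ?_⟩
    by_contra! h
    exact absurd (hx.trans (monotone_cdf η h.le)) (not_le.2 ha)
  refine ⟨fun h => ?_, fun h => csInf_le hbdd h⟩
  have hne : {x : ℝ | u ≤ cdf η x}.Nonempty := by
    obtain ⟨a, ha⟩ := ((tendsto_cdf_atTop η).eventually (lt_mem_nhds hu.2)).exists
    exact ⟨a, ha.le⟩
  have hlt : ∀ y ∈ Ioi x, u ≤ cdf η y := fun y hy => by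
    obtain ⟨z, hz, hzy⟩ := exists_lt_of_csInf_lt hne (lt_of_le_of_lt h hy)
    exact hz.trans (monotone_cdf η hzy.le)
  have hc := ((cdf η).right_continuous x).mono Ioi_subset_Ici_self
  exact ge_of_tendsto hc (eventually_nhdsWithin_of_forall hlt)

/-- The quantile function pushes the uniform law on `(0,1)` to `η`. -/
lemma map_quantile (η : Measure ℝ) [IsProbabilityMeasure η] :
    (volume.restrict (Ioo (0 : ℝ) 1)).map (quantile η) = η := by
  refine Measure.ext_of_Iic _ _ fun x => ?_
  rw [Measure.map_apply (measurable_quantile η) measurableSet_Iic,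
    Measure.restrict_apply (measurable_quantile η measurableSet_Iic)]
  have h : quantile η ⁻¹' Iic x ∩ Ioo 0 1 = Iic (cdf η x) ∩ Ioo 0 1 := by
    ext u
    simp only [mem_inter_iff, mem_preimage, mem_Iic, and_congr_left_iff]
    exact fun hu => quantile_le_iff η hu x
  have h2 : (Iic (cdf η x) ∩ Ioo 0 1 : Set ℝ) =ᵐ[volume] (Ioc 0 (cdf η x) : Set ℝ) := by
    have h3 : (Ioo (0 : ℝ) 1 : Set ℝ) =ᵐ[volume] Ioc 0 1 := Ioo_ae_eq_Ioc
    have h4 : Iic (cdf η x) ∩ Ioc 0 1 = Ioc 0 (cdf η x) := by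
      ext u
      have := cdf_le_one η x
      simp only [mem_inter_iff, mem_Iic, mem_Ioc]
      constructor
      · rintro ⟨h1, h2, -⟩; exact ⟨h2, h1⟩
      · rintro ⟨h1, h2⟩; exact ⟨h2, h1, h2.trans this⟩
    rw [← h4]
    exact (Filter.EventuallyEq.refl _ _).inter h3
  rw [h, measure_congr h2, Real.volume_Ioc, sub_zero, ofReal_cdf]

lemma integrableOn_comp_quantile {η : Measure ℝ} [IsProbabilityMeasure η] {g : ℝ → ℝ}
    (hg : Integrable g η) : IntegrableOn (fun u => g (quantile η u)) (Ioo 0 1) := by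
  rw [← map_quantile η] at hg
  exact hg.comp_measurable (measurable_quantile η)

lemma intervalIntegrable_quantile {η : Measure ℝ} [IsProbabilityMeasure η]
    (h : Integrable (fun x : ℝ => x) η) : IntervalIntegrable (quantile η) volume 0 1 :=
  (intervalIntegrable_iff_integrableOn_Ioo_of_le zero_le_one).2 (integrableOn_comp_quantile h)

lemma integral_comp_quantile (η : Measure ℝ) [IsProbabilityMeasure η] {g : ℝ → ℝ}
    (hg : Continuous g) : ∫ u in (0 : ℝ)..1, g (quantile η u) = ∫ x, g x ∂η := by
  rw [intervalIntegral.integral_of_le zero_le_one, integral_Ioc_eq_integral_Ioo]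
  conv_rhs => rw [← map_quantile η]
  rw [integral_map (measurable_quantile η).aemeasurable hg.aestronglyMeasurable]

lemma intervalIntegrable_sub_of_mem {f : ℝ → ℝ} (hf : IntervalIntegrable f volume 0 1) {a b : ℝ}
    (ha : a ∈ Icc (0 : ℝ) 1) (hb : b ∈ Icc (0 : ℝ) 1) : IntervalIntegrable f volume a b :=
  hf.mono_set (by
    rw [uIcc_of_le (zero_le_one' ℝ)]
    exact uIcc_subset_Icc ha hb)

variable {η : Measure ℝ} [IsProbabilityMeasure η]

lemma intervalIntegrable_pos_sub_quantile (h : Integrable (fun x : ℝ => x) η) (x : ℝ) :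
    IntervalIntegrable (fun u => max (x - quantile η u) 0) volume 0 1 := by
  have hi := ((integrable_const x).sub h).pos_part
  exact (intervalIntegrable_iff_integrableOn_Ioo_of_le zero_le_one).2
    (integrableOn_comp_quantile (g := fun y => max (x - y) 0) hi)

/-- Fenchel inequality: u ↦ ∫₀ᵘ F⁻¹ is the convex conjugate of x ↦ ∫ (x - y)⁺ dη. The next lemma
identifies a maximizer, x = F⁻¹(u). -/
lemma mul_sub_integral_pos_le (h : Integrable (fun x : ℝ => x) η) (x : ℝ) {u : ℝ}
    (hu : u ∈ Icc (0 : ℝ) 1) :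
    u * x - ∫ y, max (x - y) 0 ∂η ≤ ∫ w in (0 : ℝ)..u, quantile η w := by
  have h0 : (0 : ℝ) ∈ Icc (0 : ℝ) 1 := ⟨le_rfl, zero_le_one⟩
  have h1 : (1 : ℝ) ∈ Icc (0 : ℝ) 1 := ⟨zero_le_one, le_rfl⟩
  have hi := intervalIntegrable_pos_sub_quantile h x
  have hq := intervalIntegrable_quantile h
  rw [← integral_comp_quantile η (g := fun y => max (x - y) 0) (by fun_prop),
    ← intervalIntegral.integral_add_adjacent_intervals
      (intervalIntegrable_sub_of_mem hi h0 hu) (intervalIntegrable_sub_of_mem hi hu h1)]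
  have h2 : 0 ≤ ∫ w in u..1, max (x - quantile η w) 0 :=
    intervalIntegral.integral_nonneg hu.2 fun _ _ => le_max_right _ _
  have h3 : ∫ w in (0 : ℝ)..u, (x - quantile η w) ≤ ∫ w in (0 : ℝ)..u, max (x - quantile η w) 0 :=
    intervalIntegral.integral_mono_on hu.1
      (intervalIntegrable_const.sub (intervalIntegrable_sub_of_mem hq h0 hu))
      (intervalIntegrable_sub_of_mem hi h0 hu) fun _ _ => le_max_left _ _
  rw [intervalIntegral.integral_sub intervalIntegrable_const
    (intervalIntegrable_sub_of_mem hq h0 hu), intervalIntegral.integral_const, smul_eq_mul,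
    sub_zero] at h3
  linarith

/-- Equality case: by monotonicity, x - F⁻¹ is nonnegative before u and nonpositive after u when x =
F⁻¹(u). -/
lemma mul_quantile_sub_integral_pos (h : Integrable (fun x : ℝ => x) η) {u : ℝ}
    (hu : u ∈ Ioo (0 : ℝ) 1) :
    ∫ w in (0 : ℝ)..u, quantile η w
      = u * quantile η u - ∫ y, max (quantile η u - y) 0 ∂η := by
  have h0 : (0 : ℝ) ∈ Icc (0 : ℝ) 1 := ⟨le_rfl, zero_le_one⟩
  have h1 : (1 : ℝ) ∈ Icc (0 : ℝ) 1 := ⟨zero_le_one, le_rfl⟩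
  have hu' := Ioo_subset_Icc_self hu
  have hi := intervalIntegrable_pos_sub_quantile h (quantile η u)
  have hq := intervalIntegrable_quantile h
  rw [← integral_comp_quantile η (g := fun y => max (quantile η u - y) 0) (by fun_prop),
    ← intervalIntegral.integral_add_adjacent_intervals
      (intervalIntegrable_sub_of_mem hi h0 hu') (intervalIntegrable_sub_of_mem hi hu' h1)]
  have h2 : ∫ w in u..1, max (quantile η u - quantile η w) 0 = ∫ w in u..1, (0 : ℝ) := by
    rw [intervalIntegral.integral_of_le hu.2.le, intervalIntegral.integral_of_le hu.2.le,
      integral_Ioc_eq_integral_Ioo, integral_Ioc_eq_integral_Ioo]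
    refine setIntegral_congr_fun measurableSet_Ioo fun w hw => max_eq_right ?_
    exact sub_nonpos.2 (quantile_monotoneOn η hu ⟨hu.1.trans hw.1, hw.2⟩ hw.1.le)
  have h3 : ∫ w in (0 : ℝ)..u, max (quantile η u - quantile η w) 0
      = ∫ w in (0 : ℝ)..u, (quantile η u - quantile η w) := by
    rw [intervalIntegral.integral_of_le hu.1.le, intervalIntegral.integral_of_le hu.1.le]
    refine setIntegral_congr_fun measurableSet_Ioc fun w hw => max_eq_left ?_
    exact sub_nonneg.2 (quantile_monotoneOn η ⟨hw.1, hw.2.trans_lt hu.2⟩ hu hw.2)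
  rw [h2, h3, intervalIntegral.integral_sub intervalIntegrable_const
    (intervalIntegrable_sub_of_mem hq h0 hu'), intervalIntegral.integral_const,
    intervalIntegral.integral_zero, smul_eq_mul]
  ring

end Quantile

/-! ### Convex order in terms of primitives of quantile functions -/

section ConvexOrder

variable {μ ν : Measure ℝ} [IsProbabilityMeasure μ] [IsProbabilityMeasure ν]

/-- The means agree since both x and -x are convex. -/
lemma StrictConvexOrder.integral_quantile_one_eq (hν : Integrable (fun x : ℝ => x) ν)
    (hcx : StrictConvexOrder μ ν) :
    ∫ w in (0 : ℝ)..1, quantile μ w = ∫ w in (0 : ℝ)..1, quantile ν w := by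
  have e := fun η [IsProbabilityMeasure η] => integral_comp_quantile η continuous_id
  simp only [id] at e
  rw [e μ, e ν]
  have h1 := (hcx.1 (fun x => x) (convexOn_id convex_univ) hν).2
  have h2 := (hcx.1 (fun x => -x) (concaveOn_id convex_univ).neg hν.neg).2
  rw [integral_neg, integral_neg] at h2
  linarith

/-- Test the order on the convex function y ↦ (x - y)⁺ with x = F_ν⁻¹(u): the duality is an equality
for ν at this x and an inequality for μ. -/
lemma StrictConvexOrder.integral_quantile_le (hμ : Integrable (fun x : ℝ => x) μ)
    (hν : Integrable (fun x : ℝ => x) ν) (hcx : StrictConvexOrder μ ν) {u : ℝ}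
    (hu : u ∈ Icc (0 : ℝ) 1) :
    ∫ w in (0 : ℝ)..u, quantile ν w ≤ ∫ w in (0 : ℝ)..u, quantile μ w := by
  rcases hu.1.eq_or_lt with rfl | h0
  · simp
  rcases hu.2.eq_or_lt with rfl | h1
  · exact (hcx.integral_quantile_one_eq hν).ge
  have hconv : ConvexOn ℝ univ (fun y : ℝ => max (quantile ν u - y) 0) :=
    ((convexOn_const _ convex_univ).sub (concaveOn_id convex_univ)).sup
      (convexOn_const 0 convex_univ)
  have h2 := (hcx.1 _ hconv ((integrable_const _).sub hν).pos_part).2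
  have h3 := mul_sub_integral_pos_le hμ (quantile ν u) hu
  rw [mul_quantile_sub_integral_pos hν ⟨h0, h1⟩]
  linarith

end ConvexOrder

/-! ### Generalized inverses on [0,1] -/

section Level

/-- The generalized inverse `inf {r ∈ [0,1] | g r ≥ y}`. -/
noncomputable def level (g : ℝ → ℝ) (y : ℝ) : ℝ := sInf {r | r ∈ Icc (0 : ℝ) 1 ∧ y ≤ g r}

lemma bddBelow_level (g : ℝ → ℝ) (y : ℝ) : BddBelow {r | r ∈ Icc (0 : ℝ) 1 ∧ y ≤ g r} :=
  ⟨0, fun _ hr => hr.1.1⟩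

variable {g : ℝ → ℝ} {y : ℝ}

lemma level_mem_Icc (hy : y ≤ g 1) : level g y ∈ Icc (0 : ℝ) 1 :=
  ⟨le_csInf ⟨1, ⟨zero_le_one, le_rfl⟩, hy⟩ fun _ hr => hr.1.1,
    csInf_le (bddBelow_level g y) ⟨⟨zero_le_one, le_rfl⟩, hy⟩⟩

lemma le_apply_level (hg : ContinuousOn g (Icc 0 1)) (hy : y ≤ g 1) : y ≤ g (level g y) := by
  have hc : IsClosed {r | r ∈ Icc (0 : ℝ) 1 ∧ y ≤ g r} :=
    hg.preimage_isClosed_of_isClosed isClosed_Icc (isClosed_Ici (a := y))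
  exact (hc.csInf_mem ⟨1, ⟨zero_le_one, le_rfl⟩, hy⟩ (bddBelow_level g y)).2

/-- Galois connection. It yields both the law of the transport maps and the inequality u < φ(u). -/
lemma level_le_iff (hg : ContinuousOn g (Icc 0 1)) (hm : MonotoneOn g (Icc 0 1)) (hy : y ≤ g 1)
    {r : ℝ} (hr : r ∈ Icc (0 : ℝ) 1) : level g y ≤ r ↔ y ≤ g r :=
  ⟨fun h => (le_apply_level hg hy).trans (hm (level_mem_Icc hy) hr h),
    fun h => csInf_le (bddBelow_level g y) ⟨hr, h⟩⟩

lemma level_le_level {y' : ℝ} (h : y ≤ y') (hy' : y' ≤ g 1) : level g y ≤ level g y' :=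
  csInf_le_csInf (bddBelow_level g y) ⟨1, ⟨zero_le_one, le_rfl⟩, hy'⟩
    fun _ hr => ⟨hr.1, h.trans hr.2⟩

end Level

/-! ### Monotone rearrangements between densities on (0,1) -/

section ScaledDensity

/-- The measure `c⁻¹ f(u) du` on `(0,1)`. -/
noncomputable def scaledDensity (f : ℝ → ℝ) (c : ℝ) : Measure ℝ :=
  (volume.restrict (Ioo (0 : ℝ) 1)).withDensity fun u => ENNReal.ofReal (f u / c)

variable {f : ℝ → ℝ} {c : ℝ}

lemma scaledDensity_absolutelyContinuous :
    scaledDensity f c ≪ volume.restrict (Ioo (0 : ℝ) 1) := withDensity_absolutelyContinuous _ _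

lemma ae_scaledDensity_mem_Ioo : ∀ᵐ u ∂scaledDensity f c, u ∈ Ioo (0 : ℝ) 1 :=
  scaledDensity_absolutelyContinuous.ae_le (ae_restrict_mem measurableSet_Ioo)

lemma scaledDensity_congr_Ioo {s t : Set ℝ} (h : ∀ u ∈ Ioo (0 : ℝ) 1, (u ∈ s ↔ u ∈ t)) :
    scaledDensity f c s = scaledDensity f c t :=
  measure_congr (ae_scaledDensity_mem_Ioo.mono fun u hu => propext (h u hu))

lemma scaledDensity_Ioc (hf : ∀ u, 0 ≤ f u) (hi : IntervalIntegrable f volume 0 1) (hc : 0 < c)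
    {a b : ℝ} (ha : 0 ≤ a) (hab : a ≤ b) (hb : b ≤ 1) :
    scaledDensity f c (Ioc a b) = ENNReal.ofReal ((∫ u in a..b, f u) / c) := by
  have h3 : (Ioo (0 : ℝ) 1 : Set ℝ) =ᵐ[volume] Ioc 0 1 := Ioo_ae_eq_Ioc
  have h2 : (Ioc a b ∩ Ioo 0 1 : Set ℝ) =ᵐ[volume] (Ioc a b : Set ℝ) := by
    have h4 : Ioc a b ∩ Ioc 0 1 = Ioc a b :=
      inter_eq_left.2 fun u hu => ⟨ha.trans_lt hu.1, hu.2.trans hb⟩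
    conv_rhs => rw [← h4]
    exact (Filter.EventuallyEq.refl _ _).inter h3
  have hii : IntervalIntegrable f volume a b :=
    intervalIntegrable_sub_of_mem hi ⟨ha, hab.trans hb⟩ ⟨ha.trans hab, hb⟩
  rw [scaledDensity, withDensity_apply _ measurableSet_Ioc,
    Measure.restrict_restrict measurableSet_Ioc, Measure.restrict_congr_set h2,
    ← ofReal_integral_eq_lintegral_ofReal
      (((intervalIntegrable_iff_integrableOn_Ioc_of_le hab).1 hii).div_const c)
      (Filter.Eventually.of_forall fun u => div_nonneg (hf u) hc.le),
    integral_div, intervalIntegral.integral_of_le hab]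

lemma scaledDensity_Iic (hf : ∀ u, 0 ≤ f u) (hi : IntervalIntegrable f volume 0 1) (hc : 0 < c)
    {r : ℝ} (hr : r ∈ Icc (0 : ℝ) 1) :
    scaledDensity f c (Iic r) = ENNReal.ofReal ((∫ u in (0 : ℝ)..r, f u) / c) := by
  rw [← scaledDensity_Ioc hf hi hc le_rfl hr.1 hr.2]
  exact scaledDensity_congr_Ioo fun u hu => ⟨fun h => ⟨hu.1, h⟩, fun h => h.2⟩

lemma scaledDensity_univ (hf : ∀ u, 0 ≤ f u) (hi : IntervalIntegrable f volume 0 1)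
    (hc : 0 < c) : scaledDensity f c univ = ENNReal.ofReal ((∫ u in (0 : ℝ)..1, f u) / c) := by
  rw [← scaledDensity_Iic hf hi hc ⟨zero_le_one, le_rfl⟩]
  exact scaledDensity_congr_Ioo fun u hu => ⟨fun _ => hu.2.le, fun _ => mem_univ _⟩

lemma continuousOn_primitive (hi : IntervalIntegrable f volume 0 1) :
    ContinuousOn (fun u => ∫ v in (0 : ℝ)..u, f v) (Icc 0 1) := by
  have := intervalIntegral.continuousOn_primitive_interval' hi left_mem_uIcc
  rwa [uIcc_of_le (zero_le_one' ℝ)] at this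

lemma monotoneOn_primitive (hf : ∀ u, 0 ≤ f u) (hi : IntervalIntegrable f volume 0 1) :
    MonotoneOn (fun u => ∫ v in (0 : ℝ)..u, f v) (Icc 0 1) := by
  intro a ha b hb hab
  have h0 : (0 : ℝ) ∈ Icc (0 : ℝ) 1 := ⟨le_rfl, zero_le_one⟩
  have := intervalIntegral.integral_add_adjacent_intervals
    (intervalIntegrable_sub_of_mem hi h0 ha) (intervalIntegrable_sub_of_mem hi ha hb)
  have h2 : 0 ≤ ∫ v in a..b, f v := intervalIntegral.integral_nonneg hab fun v _ => hf v
  simp only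
  linarith

/-- Under `c⁻¹ f(u) du`, the primitive of `f` is uniformly distributed. -/
lemma scaledDensity_primitive_le (hf : ∀ u, 0 ≤ f u) (hi : IntervalIntegrable f volume 0 1)
    (hc : 0 < c) {y : ℝ} (hy : y ∈ Icc 0 (∫ v in (0 : ℝ)..1, f v)) :
    scaledDensity f c {u | ∫ v in (0 : ℝ)..u, f v ≤ y} = ENNReal.ofReal (y / c) := by
  have hcont := continuousOn_primitive hi
  have hmono := monotoneOn_primitive hf hi
  set Ψ : ℝ → ℝ := fun u => ∫ v in (0 : ℝ)..u, f v with hΨ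
  have hne : (Icc 0 1 ∩ Ψ ⁻¹' {y}).Nonempty := by
    have hy' : y ∈ Icc (Ψ 0) (Ψ 1) := by simpa [hΨ] using hy
    obtain ⟨r, hr, hr'⟩ := intermediate_value_Icc zero_le_one hcont hy'
    exact ⟨r, hr, hr'⟩
  have hcl : IsClosed (Icc 0 1 ∩ Ψ ⁻¹' {y}) :=
    hcont.preimage_isClosed_of_isClosed isClosed_Icc isClosed_singleton
  have hK : IsCompact (Icc 0 1 ∩ Ψ ⁻¹' {y}) := isCompact_Icc.of_isClosed_subset hcl inter_subset_left
  -- The primitive may be flat at height y; taking the right end r of that plateau makes {Ψ ≤ y}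
  -- coincide with (-∞, r] inside (0,1).
  obtain ⟨r, ⟨hr, hry⟩, hmax⟩ := hK.exists_isGreatest hne
  have hry' : ∫ v in (0 : ℝ)..r, f v = y := hry
  have h : scaledDensity f c {u | Ψ u ≤ y} = scaledDensity f c (Iic r) := by
    refine scaledDensity_congr_Ioo fun u hu => ?_
    have hu' := Ioo_subset_Icc_self hu
    refine ⟨fun h => ?_, fun h => (hmono hu' hr h).trans_eq hry⟩
    by_contra h'
    have hlt : r < u := not_le.1 h'
    exact absurd (hmax ⟨hu', le_antisymm h ((hry.symm.le).trans (hmono hr hu' hlt.le))⟩) h'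
  rw [h, scaledDensity_Iic hf hi hc hr, hry']

variable {g : ℝ → ℝ}

lemma primitive_le_one (hf : ∀ u, 0 ≤ f u) (hi : IntervalIntegrable f volume 0 1) {u : ℝ}
    (hu : u ∈ Icc (0 : ℝ) 1) : ∫ v in (0 : ℝ)..u, f v ≤ ∫ v in (0 : ℝ)..1, f v :=
  monotoneOn_primitive hf hi hu ⟨zero_le_one, le_rfl⟩ hu.2

lemma monotoneOn_level_primitive (hf : ∀ u, 0 ≤ f u) (hi : IntervalIntegrable f volume 0 1)
    (hg1 : g 1 = ∫ v in (0 : ℝ)..1, f v) :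
    MonotoneOn (fun u => level g (∫ v in (0 : ℝ)..u, f v)) (Ioo 0 1) := fun _ ha _ hb hab =>
  level_le_level
    (monotoneOn_primitive hf hi (Ioo_subset_Icc_self ha) (Ioo_subset_Icc_self hb) hab)
    (hg1 ▸ primitive_le_one hf hi (Ioo_subset_Icc_self hb))

lemma aemeasurable_level_primitive (hf : ∀ u, 0 ≤ f u) (hi : IntervalIntegrable f volume 0 1)
    (hg1 : g 1 = ∫ v in (0 : ℝ)..1, f v) :
    AEMeasurable (fun u => level g (∫ v in (0 : ℝ)..u, f v)) (scaledDensity f c) :=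
  (aemeasurable_restrict_of_monotoneOn measurableSet_Ioo
    (monotoneOn_level_primitive hf hi hg1)).mono_ac scaledDensity_absolutelyContinuous

lemma level_primitive_mem_Icc (hf : ∀ u, 0 ≤ f u) (hi : IntervalIntegrable f volume 0 1)
    (hg1 : g 1 = ∫ v in (0 : ℝ)..1, f v) {u : ℝ} (hu : u ∈ Ioo (0 : ℝ) 1) :
    level g (∫ v in (0 : ℝ)..u, f v) ∈ Icc (0 : ℝ) 1 :=
  level_mem_Icc (hg1 ▸ primitive_le_one hf hi (Ioo_subset_Icc_self hu))

/-- `level_le_iff` turns the event into {primitive ≤ g r}, and the primitive is uniform. A general g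
serves both the increasing and the decreasing rearrangement. -/
lemma scaledDensity_level_primitive_le (hf : ∀ u, 0 ≤ f u) (hi : IntervalIntegrable f volume 0 1)
    (hc : 0 < c) (hg : ContinuousOn g (Icc 0 1)) (hm : MonotoneOn g (Icc 0 1)) (hg0 : g 0 = 0)
    (hg1 : g 1 = ∫ v in (0 : ℝ)..1, f v) {r : ℝ} (hr : r ∈ Icc (0 : ℝ) 1) :
    scaledDensity f c {u | level g (∫ v in (0 : ℝ)..u, f v) ≤ r} = ENNReal.ofReal (g r / c) := by
  have h0 : (0 : ℝ) ∈ Icc (0 : ℝ) 1 := ⟨le_rfl, zero_le_one⟩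
  have h1 : (1 : ℝ) ∈ Icc (0 : ℝ) 1 := ⟨zero_le_one, le_rfl⟩
  rw [← scaledDensity_primitive_le hf hi hc
    ⟨hg0 ▸ hm h0 hr hr.1, hg1 ▸ hm hr h1 hr.2⟩]
  exact scaledDensity_congr_Ioo fun u hu =>
    level_le_iff hg hm (hg1 ▸ primitive_le_one hf hi (Ioo_subset_Icc_self hu)) hr

variable {f₂ : ℝ → ℝ}

lemma isFiniteMeasure_scaledDensity (hf : ∀ u, 0 ≤ f u) (hi : IntervalIntegrable f volume 0 1)
    (hc : 0 < c) : IsFiniteMeasure (scaledDensity f c) :=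
  ⟨by rw [scaledDensity_univ hf hi hc]; exact ENNReal.ofReal_lt_top⟩

/-- The increasing rearrangement of `c⁻¹ f` onto `c⁻¹ f₂`. -/
lemma map_level_primitive (hf : ∀ u, 0 ≤ f u) (hi : IntervalIntegrable f volume 0 1)
    (hf₂ : ∀ u, 0 ≤ f₂ u) (hi₂ : IntervalIntegrable f₂ volume 0 1) (hc : 0 < c)
    (heq : ∫ v in (0 : ℝ)..1, f₂ v = ∫ v in (0 : ℝ)..1, f v) :
    (scaledDensity f c).map
      (fun u => level (fun r => ∫ v in (0 : ℝ)..r, f₂ v) (∫ v in (0 : ℝ)..u, f v))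
      = scaledDensity f₂ c := by
  have hfin := isFiniteMeasure_scaledDensity hf hi hc
  have hfin₂ := isFiniteMeasure_scaledDensity hf₂ hi₂ hc
  refine Measure.ext_of_Iic _ _ fun r => ?_
  rw [Measure.map_apply_of_aemeasurable (aemeasurable_level_primitive hf hi heq)
    measurableSet_Iic]
  rcases lt_or_ge r 0 with hr | hr
  · rw [scaledDensity_congr_Ioo (t := ∅), scaledDensity_congr_Ioo (s := Iic r) (t := ∅)]
    · simp
    · exact fun u hu => iff_of_false (not_le.2 (hr.trans hu.1)) (notMem_empty u)
    · exact fun u hu => iff_of_false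
        (not_le.2 (hr.trans_le (level_primitive_mem_Icc hf hi heq hu).1)) (notMem_empty u)
  rcases le_or_gt r 1 with hr1 | hr1
  · rw [scaledDensity_Iic hf₂ hi₂ hc ⟨hr, hr1⟩]
    exact scaledDensity_level_primitive_le hf hi hc (continuousOn_primitive hi₂)
      (monotoneOn_primitive hf₂ hi₂) intervalIntegral.integral_same heq ⟨hr, hr1⟩
  · rw [scaledDensity_congr_Ioo (t := univ), scaledDensity_congr_Ioo (s := Iic r) (t := univ),
      scaledDensity_univ hf hi hc, scaledDensity_univ hf₂ hi₂ hc, heq]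
    · exact fun u hu => iff_of_true (hu.2.trans hr1).le (mem_univ u)
    · exact fun u hu => iff_of_true
        ((level_primitive_mem_Icc hf hi heq hu).2.trans hr1.le) (mem_univ u)

lemma primitive_reflect (hi : IntervalIntegrable f volume 0 1) {u : ℝ} (hu : u ∈ Icc (0 : ℝ) 1) :
    ∫ v in (1 - u)..1, f v = (∫ v in (0 : ℝ)..1, f v) - ∫ v in (0 : ℝ)..(1 - u), f v := by
  have h0 : (0 : ℝ) ∈ Icc (0 : ℝ) 1 := ⟨le_rfl, zero_le_one⟩
  have h1 : (1 : ℝ) ∈ Icc (0 : ℝ) 1 := ⟨zero_le_one, le_rfl⟩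
  have hu' : 1 - u ∈ Icc (0 : ℝ) 1 := ⟨by linarith [hu.2], by linarith [hu.1]⟩
  have := intervalIntegral.integral_add_adjacent_intervals
    (intervalIntegrable_sub_of_mem hi h0 hu') (intervalIntegrable_sub_of_mem hi hu' h1)
  linarith

lemma continuousOn_primitive_reflect (hi : IntervalIntegrable f volume 0 1) :
    ContinuousOn (fun u => ∫ v in (1 - u)..1, f v) (Icc 0 1) := by
  have h : MapsTo (fun u : ℝ => 1 - u) (Icc 0 1) (Icc 0 1) := fun u hu =>
    ⟨by linarith [hu.2], by linarith [hu.1]⟩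
  exact (continuousOn_const.sub ((continuousOn_primitive hi).comp (by fun_prop) h)).congr
    fun u hu => primitive_reflect hi hu

lemma monotoneOn_primitive_reflect (hf : ∀ u, 0 ≤ f u) (hi : IntervalIntegrable f volume 0 1) :
    MonotoneOn (fun u => ∫ v in (1 - u)..1, f v) (Icc 0 1) := by
  intro a ha b hb hab
  have := monotoneOn_primitive hf hi (a := 1 - b) (b := 1 - a)
    ⟨by linarith [hb.2], by linarith [hb.1]⟩ ⟨by linarith [ha.2], by linarith [ha.1]⟩ (by linarith)
  simp only at this ⊢
  rw [primitive_reflect hi ha, primitive_reflect hi hb]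
  linarith

/-- The decreasing rearrangement of `c⁻¹ f` onto `c⁻¹ f₂`. -/
lemma map_one_sub_level_primitive (hf : ∀ u, 0 ≤ f u) (hi : IntervalIntegrable f volume 0 1)
    (hf₂ : ∀ u, 0 ≤ f₂ u) (hi₂ : IntervalIntegrable f₂ volume 0 1) (hc : 0 < c)
    (heq : ∫ v in (0 : ℝ)..1, f₂ v = ∫ v in (0 : ℝ)..1, f v) :
    (scaledDensity f c).map
      (fun u => 1 - level (fun r => ∫ v in (1 - r)..1, f₂ v) (∫ v in (0 : ℝ)..u, f v))
      = scaledDensity f₂ c := by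
  have hfin := isFiniteMeasure_scaledDensity hf hi hc
  have hfin₂ := isFiniteMeasure_scaledDensity hf₂ hi₂ hc
  have heq' : ∫ v in (1 - 1 : ℝ)..1, f₂ v = ∫ v in (0 : ℝ)..1, f v := by rwa [sub_self]
  -- Upper half-lines are used because 1 - level ≥ r means level ≤ 1 - r, the form that the Galois
  -- connection handles.
  refine Measure.ext_of_Ici _ _ fun r => ?_
  rw [Measure.map_apply_of_aemeasurable
    ((aemeasurable_level_primitive (g := fun r => ∫ v in (1 - r)..1, f₂ v) hf hi heq').const_sub 1)
    measurableSet_Ici]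
  have hmem := fun u hu =>
    level_primitive_mem_Icc (g := fun r => ∫ v in (1 - r)..1, f₂ v) (u := u) hf hi heq' hu
  rcases lt_or_ge 1 r with hr | hr
  · rw [scaledDensity_congr_Ioo (t := ∅), scaledDensity_congr_Ioo (s := Ici r) (t := ∅)]
    · simp
    · exact fun u hu => iff_of_false (not_le.2 (hu.2.trans hr)) (notMem_empty u)
    · refine fun u hu => iff_of_false (fun h => ?_) (notMem_empty u)
      simp only [mem_preimage, mem_Ici] at h
      linarith [(hmem u hu).1]
  rcases le_or_gt 0 r with hr1 | hr1
  · have hr' : 1 - r ∈ Icc (0 : ℝ) 1 := ⟨by linarith, by linarith⟩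
    have h1 := scaledDensity_level_primitive_le (g := fun r => ∫ v in (1 - r)..1, f₂ v) hf hi hc
      (continuousOn_primitive_reflect hi₂) (monotoneOn_primitive_reflect hf₂ hi₂) (by simp)
      heq' hr'
    simp only [sub_sub_cancel] at h1
    rw [← scaledDensity_Ioc hf₂ hi₂ hc hr1 hr le_rfl] at h1
    have h2 : scaledDensity f₂ c (Ici r) = scaledDensity f₂ c (Ioc r 1) := by
      -- Absence of atoms allows the endpoint r to be dropped.
      have hna : NullSingletonClass (scaledDensity f₂ c) :=
        ⟨fun x => scaledDensity_absolutelyContinuous (measure_singleton x)⟩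
      rw [← measure_congr (Ioi_ae_eq_Ici (μ := scaledDensity f₂ c) (a := r))]
      exact scaledDensity_congr_Ioo fun u hu => ⟨fun h => ⟨h, hu.2.le⟩, fun h => h.1⟩
    rw [h2, ← h1]
    congr 1
    ext u
    simp only [mem_preimage, mem_Ici, mem_ofPred_eq]
    constructor <;> intro h <;> linarith
  · rw [scaledDensity_congr_Ioo (t := univ), scaledDensity_congr_Ioo (s := Ici r) (t := univ),
      scaledDensity_univ hf hi hc, scaledDensity_univ hf₂ hi₂ hc, heq]
    · exact fun u hu => iff_of_true (hr1.trans hu.1).le (mem_univ u)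
    · refine fun u hu => iff_of_true ?_ (mem_univ u)
      have := (hmem u hu).2
      simp only [mem_preimage, mem_Ici]
      linarith

end ScaledDensity

/-! ### Power functions as mixtures of piecewise linear functions -/

section Layers

/-- The integrand lives on (0, x], and p > 2 is what makes t^(p-3) integrable at 0. -/
lemma setLIntegral_ofReal_sub_mul_rpow {p : ℝ} (hp : 2 < p) {x : ℝ} (hx : 0 < x) :
    ∫⁻ t in Ioi 0, ENNReal.ofReal (t ^ (p - 3)) * ENNReal.ofReal (x - t) =
      ENNReal.ofReal (1 / (p - 2) - 1 / (p - 1)) * ENNReal.ofReal (x ^ (p - 1)) := by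
  have hsplit : Ioi (0 : ℝ) = Ioc 0 x ∪ Ioi x := (Ioc_union_Ioi_eq_Ioi hx.le).symm
  have h1 : ∫⁻ t in Ioi x, ENNReal.ofReal (t ^ (p - 3)) * ENNReal.ofReal (x - t) = 0 := by
    rw [setLIntegral_congr_fun (g := fun _ => 0) measurableSet_Ioi]
    · simp
    · intro t ht
      have : x - t ≤ 0 := by linarith [mem_Ioi.1 ht]
      simp [ENNReal.ofReal_of_nonpos this]
  have h2 : ∫⁻ t in Ioc 0 x, ENNReal.ofReal (t ^ (p - 3)) * ENNReal.ofReal (x - t) =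
      ∫⁻ t in Ioc 0 x, ENNReal.ofReal (x * t ^ (p - 3) - t ^ (p - 2)) := by
    refine setLIntegral_congr_fun measurableSet_Ioc fun t ht => ?_
    have : t ^ (p - 2) = t ^ (p - 3) * t := by
      rw [← Real.rpow_add_one ht.1.ne']; congr 1; ring
    rw [← ENNReal.ofReal_mul (Real.rpow_nonneg ht.1.le _), this]
    congr 1; ring
  have hi1 : IntervalIntegrable (fun t : ℝ => t ^ (p - 3)) volume 0 x :=
    intervalIntegral.intervalIntegrable_rpow' (by linarith)
  have hi2 : IntervalIntegrable (fun t : ℝ => t ^ (p - 2)) volume 0 x :=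
    intervalIntegral.intervalIntegrable_rpow' (by linarith)
  rw [hsplit, lintegral_union measurableSet_Ioi Ioc_disjoint_Ioi_same, h1, add_zero, h2,
    ← ofReal_integral_eq_lintegral_ofReal, ← intervalIntegral.integral_of_le hx.le,
    intervalIntegral.integral_sub (hi1.const_mul x) hi2, intervalIntegral.integral_const_mul,
    integral_rpow (Or.inl (by linarith)), integral_rpow (Or.inl (by linarith)),
    ← ENNReal.ofReal_mul]
  · congr 1
    rw [Real.zero_rpow (by linarith), Real.zero_rpow (by linarith)]
    have e1 : x ^ (p - 3 + 1) * x = x ^ (p - 1) := by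
      rw [← Real.rpow_add_one hx.ne']; congr 1; ring
    have e2 : p - 2 + 1 = p - 1 := by ring
    have e3 : p - 3 + 1 = p - 2 := by ring
    rw [e2, e3, ← e1, e3]
    have : p - 2 ≠ 0 := by linarith
    have : p - 1 ≠ 0 := by linarith
    field_simp
    ring
  · rw [sub_nonneg]
    exact one_div_le_one_div_of_le (by linarith) (by linarith)
  · exact (intervalIntegrable_iff_integrableOn_Ioc_of_le hx.le).1 ((hi1.const_mul x).sub hi2)
  · filter_upwards [ae_restrict_mem measurableSet_Ioc] with t ht
    have : t ^ (p - 2) = t * t ^ (p - 3) := by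
      rw [mul_comm, ← Real.rpow_add_one ht.1.ne']; congr 1; ring
    rw [Pi.zero_apply, sub_nonneg, this]
    exact mul_le_mul_of_nonneg_right ht.2 (Real.rpow_nonneg ht.1.le _)

/-- The integrand now lives on (x, ∞), and p < 1 makes t^(p-2) integrable at infinity. -/
lemma setLIntegral_ofReal_sub_mul_rpow_of_lt_one {p : ℝ} (hp : p < 1) {x : ℝ} (hx : 0 < x) :
    ∫⁻ t in Ioi 0, ENNReal.ofReal (t ^ (p - 3)) * ENNReal.ofReal (t - x) =
      ENNReal.ofReal (1 / (1 - p) - 1 / (2 - p)) * ENNReal.ofReal (x ^ (p - 1)) := by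
  have hsplit : Ioi (0 : ℝ) = Ioc 0 x ∪ Ioi x := (Ioc_union_Ioi_eq_Ioi hx.le).symm
  have h1 : ∫⁻ t in Ioc 0 x, ENNReal.ofReal (t ^ (p - 3)) * ENNReal.ofReal (t - x) = 0 := by
    rw [setLIntegral_congr_fun (g := fun _ => 0) measurableSet_Ioc]
    · simp
    · intro t ht
      have : t - x ≤ 0 := by linarith [ht.2]
      simp [ENNReal.ofReal_of_nonpos this]
  have h2 : ∫⁻ t in Ioi x, ENNReal.ofReal (t ^ (p - 3)) * ENNReal.ofReal (t - x) =
      ∫⁻ t in Ioi x, ENNReal.ofReal (t ^ (p - 2) - x * t ^ (p - 3)) := by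
    refine setLIntegral_congr_fun measurableSet_Ioi fun t ht => ?_
    have ht0 : 0 < t := hx.trans ht
    have : t ^ (p - 2) = t ^ (p - 3) * t := by
      rw [← Real.rpow_add_one ht0.ne']; congr 1; ring
    rw [← ENNReal.ofReal_mul (Real.rpow_nonneg ht0.le _), this]
    congr 1; ring
  have hi1 : IntegrableOn (fun t : ℝ => t ^ (p - 3)) (Ioi x) :=
    integrableOn_Ioi_rpow_of_lt (by linarith) hx
  have hi2 : IntegrableOn (fun t : ℝ => t ^ (p - 2)) (Ioi x) :=
    integrableOn_Ioi_rpow_of_lt (by linarith) hx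
  rw [hsplit, lintegral_union measurableSet_Ioi Ioc_disjoint_Ioi_same, h1, zero_add, h2,
    ← ofReal_integral_eq_lintegral_ofReal, integral_sub hi2 (hi1.const_mul x),
    integral_const_mul, integral_Ioi_rpow_of_lt (by linarith) hx,
    integral_Ioi_rpow_of_lt (by linarith) hx, ← ENNReal.ofReal_mul]
  · congr 1
    have e1 : x ^ (p - 1) = x * x ^ (p - 2) := by
      rw [mul_comm, ← Real.rpow_add_one hx.ne']; congr 1; ring
    have e2 : p - 2 + 1 = p - 1 := by ring
    have e3 : p - 3 + 1 = p - 2 := by ring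
    rw [e2, e3, e1]
    have h3 : p - 2 ≠ 0 := by linarith
    have h4 : p - 1 ≠ 0 := by linarith
    have h5 : 1 - p = -(p - 1) := by ring
    have h6 : 2 - p = -(p - 2) := by ring
    rw [h5, h6]
    field_simp
  · rw [sub_nonneg]
    exact one_div_le_one_div_of_le (by linarith) (by linarith)
  · exact hi2.sub (hi1.const_mul x)
  · filter_upwards [ae_restrict_mem measurableSet_Ioi] with t ht
    have ht0 : 0 < t := hx.trans ht
    have : t ^ (p - 2) = t * t ^ (p - 3) := by
      rw [mul_comm, ← Real.rpow_add_one ht0.ne']; congr 1; ring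
    rw [Pi.zero_apply, sub_nonneg, this]
    exact mul_le_mul_of_nonneg_right (le_of_lt ht) (Real.rpow_nonneg ht0.le _)

/-- The integrand is t^(p-2) before x and x t^(p-3) after it; integrability at 0 needs p > 1 and at
infinity p < 2. -/
lemma setLIntegral_ofReal_min_mul_rpow {p : ℝ} (hp1 : 1 < p) (hp2 : p < 2) {x : ℝ} (hx : 0 < x) :
    ∫⁻ t in Ioi 0, ENNReal.ofReal (t ^ (p - 3)) * ENNReal.ofReal (min x t) =
      ENNReal.ofReal (1 / (p - 1) + 1 / (2 - p)) * ENNReal.ofReal (x ^ (p - 1)) := by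
  have hsplit : Ioi (0 : ℝ) = Ioc 0 x ∪ Ioi x := (Ioc_union_Ioi_eq_Ioi hx.le).symm
  have h1 : ∫⁻ t in Ioc 0 x, ENNReal.ofReal (t ^ (p - 3)) * ENNReal.ofReal (min x t) =
      ∫⁻ t in Ioc 0 x, ENNReal.ofReal (t ^ (p - 2)) := by
    refine setLIntegral_congr_fun measurableSet_Ioc fun t ht => ?_
    have : t ^ (p - 2) = t ^ (p - 3) * t := by
      rw [← Real.rpow_add_one ht.1.ne']; congr 1; ring
    rw [← ENNReal.ofReal_mul (Real.rpow_nonneg ht.1.le _), this, min_eq_right ht.2]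
  have h2 : ∫⁻ t in Ioi x, ENNReal.ofReal (t ^ (p - 3)) * ENNReal.ofReal (min x t) =
      ∫⁻ t in Ioi x, ENNReal.ofReal (t ^ (p - 3) * x) := by
    refine setLIntegral_congr_fun measurableSet_Ioi fun t ht => ?_
    rw [← ENNReal.ofReal_mul (Real.rpow_nonneg (hx.trans ht).le _), min_eq_left (le_of_lt ht)]
  have hi1 : IntegrableOn (fun t : ℝ => t ^ (p - 3)) (Ioi x) :=
    integrableOn_Ioi_rpow_of_lt (by linarith) hx
  have hi2 : IntervalIntegrable (fun t : ℝ => t ^ (p - 2)) volume 0 x :=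
    intervalIntegral.intervalIntegrable_rpow' (by linarith)
  rw [hsplit, lintegral_union measurableSet_Ioi Ioc_disjoint_Ioi_same, h1, h2,
    ← ofReal_integral_eq_lintegral_ofReal, ← ofReal_integral_eq_lintegral_ofReal,
    ← intervalIntegral.integral_of_le hx.le, integral_rpow (Or.inl (by linarith)),
    integral_mul_const, integral_Ioi_rpow_of_lt (by linarith) hx, ← ENNReal.ofReal_mul,
    ← ENNReal.ofReal_add]
  · congr 1
    have e1 : x ^ (p - 1) = x * x ^ (p - 2) := by
      rw [mul_comm, ← Real.rpow_add_one hx.ne']; congr 1; ring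
    have e2 : p - 2 + 1 = p - 1 := by ring
    have e3 : p - 3 + 1 = p - 2 := by ring
    rw [e2, e3, Real.zero_rpow (by linarith), e1]
    have h3 : p - 2 ≠ 0 := by linarith
    have h4 : p - 1 ≠ 0 := by linarith
    have h6 : 2 - p = -(p - 2) := by ring
    rw [h6]
    field_simp
    ring
  · rw [Real.zero_rpow (by linarith), sub_zero]
    exact div_nonneg (Real.rpow_nonneg hx.le _) (by linarith)
  · refine mul_nonneg ?_ hx.le
    exact div_nonneg_of_nonpos (neg_nonpos.2 (Real.rpow_nonneg hx.le _)) (by linarith)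
  · exact add_nonneg (one_div_nonneg.2 (by linarith)) (one_div_nonneg.2 (by linarith))
  · exact hi1.mul_const x
  · filter_upwards [ae_restrict_mem measurableSet_Ioi] with t ht
    exact mul_nonneg (Real.rpow_nonneg (hx.trans ht).le _) hx.le
  · exact (intervalIntegrable_iff_integrableOn_Ioc_of_le hx.le).1 hi2
  · filter_upwards [ae_restrict_mem measurableSet_Ioc] with t ht
    exact Real.rpow_nonneg ht.1.le _

end Layers

/-! ### Layer-cake comparison of integrals -/

section Domination

variable {α β : Type*} [MeasurableSpace α] [MeasurableSpace β]

/-- Layer-cake comparison: if `h = c⁻¹ W(S_z)` almost surely, then integrals of `h` compare as soon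
as the measures of the sections of `S` do. -/
lemma lintegral_le_of_section_le {P P' : Measure α} [SFinite P] [SFinite P'] {W : Measure β}
    [SFinite W] {S : Set (α × β)} (hS : MeasurableSet S) {h : α → ℝ≥0∞} {c : ℝ≥0∞}
    (hc0 : c ≠ 0) (hc : c ≠ ∞)
    (hP : ∀ᵐ z ∂P, W (Prod.mk z ⁻¹' S) = c * h z) (hP' : ∀ᵐ z ∂P', W (Prod.mk z ⁻¹' S) = c * h z)
    (hle : ∀ y, P ((fun z => (z, y)) ⁻¹' S) ≤ P' ((fun z => (z, y)) ⁻¹' S)) :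
    ∫⁻ z, h z ∂P ≤ ∫⁻ z, h z ∂P' := by
  have key : ∫⁻ z, W (Prod.mk z ⁻¹' S) ∂P ≤ ∫⁻ z, W (Prod.mk z ⁻¹' S) ∂P' := by
    -- Tonelli: the integral of W(S_z) against P is the integral of the P-measures of the other
    -- sections against W.
    rw [← Measure.prod_apply hS, ← Measure.prod_apply hS, Measure.prod_apply_symm hS,
      Measure.prod_apply_symm hS]
    exact lintegral_mono hle
  rw [lintegral_congr_ae hP, lintegral_congr_ae hP', lintegral_const_mul' _ _ hc,
    lintegral_const_mul' _ _ hc] at key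
  exact (ENNReal.mul_le_mul_iff_right hc0 hc).1 key

/-- The measure `t^(p-3) dt ⊗ ds` on `(0,∞) × ℝ`. -/
noncomputable def layerMeasure (p : ℝ) : Measure (ℝ × ℝ) :=
  ((volume.restrict (Ioi (0 : ℝ))).withDensity fun t => ENNReal.ofReal (t ^ (p - 3))).prod volume

instance (p : ℝ) : SFinite (layerMeasure p) := by unfold layerMeasure; infer_instance

lemma layerMeasure_apply (p : ℝ) {T : Set (ℝ × ℝ)} (hT : MeasurableSet T) {k : ℝ → ℝ}
    (hk : Measurable k) (h : ∀ t, 0 < t → volume (Prod.mk t ⁻¹' T) = ENNReal.ofReal (k t)) :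
    layerMeasure p T =
      ∫⁻ t in Ioi 0, ENNReal.ofReal (t ^ (p - 3)) * ENNReal.ofReal (k t) := by
  have hac := withDensity_absolutelyContinuous (volume.restrict (Ioi (0 : ℝ)))
    (fun t => ENNReal.ofReal (t ^ (p - 3)))
  have hae : ∀ᵐ t ∂((volume.restrict (Ioi (0 : ℝ))).withDensity
      fun t => ENNReal.ofReal (t ^ (p - 3))), volume (Prod.mk t ⁻¹' T) = ENNReal.ofReal (k t) :=
    hac.ae_le ((ae_restrict_mem measurableSet_Ioi).mono h)
  rw [layerMeasure, Measure.prod_apply hT, lintegral_congr_ae hae,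
    lintegral_withDensity_eq_lintegral_mul _ (by fun_prop) (by fun_prop)]
  rfl

end Domination

/-! ### Power costs under the ordering of joint distribution functions -/

section Frechet

variable {P P' : Measure (ℝ × ℝ)}

/-- `P` and `P'` have the same marginals, are carried by `{a < b}`, and `P` is dominated by `P'`
on lower-left quadrants. -/
structure QuadrantLE (P P' : Measure (ℝ × ℝ)) : Prop where
  fst_eq : P.map Prod.fst = P'.map Prod.fst
  snd_eq : P.map Prod.snd = P'.map Prod.snd
  lt_left : ∀ᵐ z ∂P, z.1 < z.2
  lt_right : ∀ᵐ z ∂P', z.1 < z.2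
  le : ∀ s r, P (Iic s ×ˢ Iic r) ≤ P' (Iic s ×ˢ Iic r)

namespace QuadrantLE

lemma preimage_fst_eq (H : QuadrantLE P P') {s : Set ℝ} (hs : MeasurableSet s) :
    P (Prod.fst ⁻¹' s) = P' (Prod.fst ⁻¹' s) := by
  rw [← Measure.map_apply measurable_fst hs, H.fst_eq, Measure.map_apply measurable_fst hs]

lemma preimage_snd_eq (H : QuadrantLE P P') {s : Set ℝ} (hs : MeasurableSet s) :
    P (Prod.snd ⁻¹' s) = P' (Prod.snd ⁻¹' s) := by
  rw [← Measure.map_apply measurable_snd hs, H.snd_eq, Measure.map_apply measurable_snd hs]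

lemma univ_eq (H : QuadrantLE P P') : P univ = P' univ := by
  simpa using H.preimage_fst_eq MeasurableSet.univ

/-- A marginal minus the joint distribution function, hence decreasing in the latter. The same holds
for `measure_lt_le`. -/
lemma measure_le_lt [IsFiniteMeasure P] (s r : ℝ) : P {z | z.1 ≤ s ∧ r < z.2} =
    P (Prod.fst ⁻¹' Iic s) - P (Iic s ×ˢ Iic r) := by
  rw [← measure_sdiff _ (measurableSet_Iic.prod measurableSet_Iic).nullMeasurableSet
    (measure_ne_top _ _)]
  · congr 1
    ext z
    simp only [mem_ofPred_eq, mem_sdiff, mem_preimage, mem_Iic, mem_prod]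
    grind
  · exact fun z hz => hz.1

lemma measure_lt_le [IsFiniteMeasure P] (s r : ℝ) : P {z | s < z.1 ∧ z.2 ≤ r} =
    P (Prod.snd ⁻¹' Iic r) - P (Iic s ×ˢ Iic r) := by
  rw [← measure_sdiff _ (measurableSet_Iic.prod measurableSet_Iic).nullMeasurableSet
    (measure_ne_top _ _)]
  · congr 1
    ext z
    simp only [mem_ofPred_eq, mem_sdiff, mem_preimage, mem_Iic, mem_prod]
    grind
  · exact fun z hz => hz.2

/-- As a < b almost surely, {b ≤ s} is the quadrant {a ≤ s, b ≤ s}. The joint distribution function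
therefore enters with a plus sign, which reverses the comparison for exponents between 1 and 2. -/
lemma measure_le_lt_le [IsFiniteMeasure P] (h : ∀ᵐ z ∂P, z.1 < z.2) {s r : ℝ} (hsr : s ≤ r) :
    P {z | z.1 ≤ s ∧ s < z.2 ∧ z.2 ≤ r} =
      P (Iic s ×ˢ Iic r) - P (Prod.snd ⁻¹' Iic s) := by
  have h1 : P (Prod.snd ⁻¹' Iic s) = P (Iic s ×ˢ Iic s) := by
    refine measure_congr (h.mono fun z hz => propext ?_)
    exact ⟨fun h => ⟨hz.le.trans h, h⟩, fun h => h.2⟩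
  rw [h1, ← measure_sdiff _ (measurableSet_Iic.prod measurableSet_Iic).nullMeasurableSet
    (measure_ne_top _ _)]
  · congr 1
    ext z
    simp only [mem_ofPred_eq, mem_sdiff, mem_Iic, mem_prod]
    grind
  · exact fun z hz => ⟨hz.1, hz.2.trans hsr⟩

/-- With r = s the joint distribution function is itself a marginal, so only marginals remain; this
is the source of equality at exponent 2. -/
lemma measure_le_lt_self [IsFiniteMeasure P] (h : ∀ᵐ z ∂P, z.1 < z.2) (s : ℝ) :
    P {z | z.1 ≤ s ∧ s < z.2} = P (Prod.fst ⁻¹' Iic s) - P (Prod.snd ⁻¹' Iic s) := by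
  have h1 : P (Prod.snd ⁻¹' Iic s) = P (Iic s ×ˢ Iic s) := by
    refine measure_congr (h.mono fun z hz => propext ?_)
    exact ⟨fun h => ⟨hz.le.trans h, h⟩, fun h => h.2⟩
  rw [h1, measure_le_lt]

lemma lintegral_rpow_le_of_two_lt [IsFiniteMeasure P] [IsFiniteMeasure P']
    (H : QuadrantLE P P') {p : ℝ} (hp : 2 < p) :
    ∫⁻ z, ENNReal.ofReal ((z.2 - z.1) ^ (p - 1)) ∂P' ≤
      ∫⁻ z, ENNReal.ofReal ((z.2 - z.1) ^ (p - 1)) ∂P := by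
  set S : Set ((ℝ × ℝ) × (ℝ × ℝ)) := {w | w.1.1 ≤ w.2.2 ∧ w.2.1 + w.2.2 < w.1.2} with hSdef
  have hS : MeasurableSet S := by
    rw [hSdef]; simp only [ofPred_and]; exact (measurableSet_le (by fun_prop) (by fun_prop)).inter
      (measurableSet_lt (by fun_prop) (by fun_prop))
  have hW : ∀ z : ℝ × ℝ, z.1 < z.2 → layerMeasure p (Prod.mk z ⁻¹' S) =
      ENNReal.ofReal (1 / (p - 2) - 1 / (p - 1)) * ENNReal.ofReal ((z.2 - z.1) ^ (p - 1)) := by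
    intro z hz
    rw [← setLIntegral_ofReal_sub_mul_rpow hp (sub_pos.2 hz)]
    refine layerMeasure_apply p (measurable_prodMk_left hS) (by fun_prop) fun t _ => ?_
    -- The slice has length (b - a - t)⁺.
    have : Prod.mk t ⁻¹' (Prod.mk z ⁻¹' S) = Ico z.1 (z.2 - t) := by
      ext s
      simp only [hSdef, mem_preimage, mem_ofPred_eq, mem_Ico, lt_sub_iff_add_lt']
    rw [this, Real.volume_Ico]
    congr 1; ring
  refine lintegral_le_of_section_le (W := layerMeasure p) hS ?_ ENNReal.ofReal_ne_top
    (H.lt_right.mono hW) (H.lt_left.mono hW) fun y => ?_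
  · rw [ne_eq, ENNReal.ofReal_eq_zero, not_le, sub_pos]
    exact one_div_lt_one_div_of_lt (by linarith) (by linarith)
  · change P' {z | z.1 ≤ y.2 ∧ y.1 + y.2 < z.2} ≤ P {z | z.1 ≤ y.2 ∧ y.1 + y.2 < z.2}
    rw [measure_le_lt, measure_le_lt, H.preimage_fst_eq measurableSet_Iic]
    exact tsub_le_tsub_left (H.le _ _) _

lemma lintegral_rpow_le_of_lt_one [IsFiniteMeasure P] [IsFiniteMeasure P']
    (H : QuadrantLE P P') {p : ℝ} (hp : p < 1) :
    ∫⁻ z, ENNReal.ofReal ((z.2 - z.1) ^ (p - 1)) ∂P' ≤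
      ∫⁻ z, ENNReal.ofReal ((z.2 - z.1) ^ (p - 1)) ∂P := by
  set S : Set ((ℝ × ℝ) × (ℝ × ℝ)) := {w | w.2.2 < w.1.1 ∧ w.1.2 ≤ w.2.1 + w.2.2} with hSdef
  have hS : MeasurableSet S := by
    rw [hSdef]; simp only [ofPred_and]; exact (measurableSet_lt (by fun_prop) (by fun_prop)).inter
      (measurableSet_le (by fun_prop) (by fun_prop))
  have hW : ∀ z : ℝ × ℝ, z.1 < z.2 → layerMeasure p (Prod.mk z ⁻¹' S) =
      ENNReal.ofReal (1 / (1 - p) - 1 / (2 - p)) * ENNReal.ofReal ((z.2 - z.1) ^ (p - 1)) := by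
    intro z hz
    rw [← setLIntegral_ofReal_sub_mul_rpow_of_lt_one hp (sub_pos.2 hz)]
    refine layerMeasure_apply p (measurable_prodMk_left hS) (by fun_prop) fun t _ => ?_
    -- The slice has length (t - (b - a))⁺.
    have : Prod.mk t ⁻¹' (Prod.mk z ⁻¹' S) = Ico (z.2 - t) z.1 := by
      ext s
      simp only [hSdef, mem_preimage, mem_ofPred_eq, mem_Ico, sub_le_iff_le_add', and_comm]
    rw [this, Real.volume_Ico]
    congr 1; ring
  refine lintegral_le_of_section_le (W := layerMeasure p) hS ?_ ENNReal.ofReal_ne_top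
    (H.lt_right.mono hW) (H.lt_left.mono hW) fun y => ?_
  · rw [ne_eq, ENNReal.ofReal_eq_zero, not_le, sub_pos]
    exact one_div_lt_one_div_of_lt (by linarith) (by linarith)
  · change P' {z | y.2 < z.1 ∧ z.2 ≤ y.1 + y.2} ≤ P {z | y.2 < z.1 ∧ z.2 ≤ y.1 + y.2}
    rw [measure_lt_le, measure_lt_le, H.preimage_snd_eq measurableSet_Iic]
    exact tsub_le_tsub_left (H.le _ _) _

lemma lintegral_rpow_le_of_mem_Ioo [IsFiniteMeasure P] [IsFiniteMeasure P']
    (H : QuadrantLE P P') {p : ℝ} (hp1 : 1 < p) (hp2 : p < 2) :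
    ∫⁻ z, ENNReal.ofReal ((z.2 - z.1) ^ (p - 1)) ∂P ≤
      ∫⁻ z, ENNReal.ofReal ((z.2 - z.1) ^ (p - 1)) ∂P' := by
  set S : Set ((ℝ × ℝ) × (ℝ × ℝ)) :=
    {w | w.1.1 ≤ w.2.2 ∧ w.2.2 < w.1.2 ∧ w.1.2 ≤ w.2.1 + w.2.2} with hSdef
  have hS : MeasurableSet S := by
    rw [hSdef]; simp only [ofPred_and]; exact (measurableSet_le (by fun_prop) (by fun_prop)).inter
      ((measurableSet_lt (by fun_prop) (by fun_prop)).inter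
      (measurableSet_le (by fun_prop) (by fun_prop)))
  have hW : ∀ z : ℝ × ℝ, z.1 < z.2 → layerMeasure p (Prod.mk z ⁻¹' S) =
      ENNReal.ofReal (1 / (p - 1) + 1 / (2 - p)) * ENNReal.ofReal ((z.2 - z.1) ^ (p - 1)) := by
    intro z hz
    rw [← setLIntegral_ofReal_min_mul_rpow hp1 hp2 (sub_pos.2 hz)]
    refine layerMeasure_apply p (measurable_prodMk_left hS) (by fun_prop) fun t _ => ?_
    -- The slice has length min(b - a, t).
    have : Prod.mk t ⁻¹' (Prod.mk z ⁻¹' S) = Ico (max z.1 (z.2 - t)) z.2 := by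
      ext s
      simp only [hSdef, mem_preimage, mem_ofPred_eq, mem_Ico, max_le_iff, sub_le_iff_le_add']
      tauto
    rw [this, Real.volume_Ico, ← min_sub_sub_left]
    congr 2; ring
  refine lintegral_le_of_section_le (W := layerMeasure p) hS ?_ ENNReal.ofReal_ne_top
    (H.lt_left.mono hW) (H.lt_right.mono hW) fun y => ?_
  · rw [ne_eq, ENNReal.ofReal_eq_zero, not_le]
    exact add_pos (one_div_pos.2 (by linarith)) (one_div_pos.2 (by linarith))
  · change P {z | z.1 ≤ y.2 ∧ y.2 < z.2 ∧ z.2 ≤ y.1 + y.2} ≤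
      P' {z | z.1 ≤ y.2 ∧ y.2 < z.2 ∧ z.2 ≤ y.1 + y.2}
    -- Sections are compared at every point of the plane, so t = y.1 may be negative; the event is
    -- then empty.
    rcases le_or_gt y.2 (y.1 + y.2) with hy | hy
    · rw [measure_le_lt_le H.lt_left hy, measure_le_lt_le H.lt_right hy,
        H.preimage_snd_eq measurableSet_Iic]
      exact tsub_le_tsub_right (H.le _ _) _
    · have : {z : ℝ × ℝ | z.1 ≤ y.2 ∧ y.2 < z.2 ∧ z.2 ≤ y.1 + y.2} = ∅ :=
        eq_empty_of_forall_notMem fun z hz => (hz.2.1.trans_le hz.2.2).not_gt hy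
      simp [this]

lemma lintegral_rpow_one_eq (H : QuadrantLE P P') :
    ∫⁻ z, ENNReal.ofReal ((z.2 - z.1) ^ ((1 : ℝ) - 1)) ∂P =
      ∫⁻ z, ENNReal.ofReal ((z.2 - z.1) ^ ((1 : ℝ) - 1)) ∂P' := by
  simp [H.univ_eq]

/-- Here b - a is the length of {s | a ≤ s < b}, with no weight in t. -/
lemma lintegral_rpow_two_eq [IsFiniteMeasure P] [IsFiniteMeasure P']
    (H : QuadrantLE P P') :
    ∫⁻ z, ENNReal.ofReal ((z.2 - z.1) ^ ((2 : ℝ) - 1)) ∂P =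
      ∫⁻ z, ENNReal.ofReal ((z.2 - z.1) ^ ((2 : ℝ) - 1)) ∂P' := by
  set S : Set ((ℝ × ℝ) × ℝ) := {w | w.1.1 ≤ w.2 ∧ w.2 < w.1.2} with hSdef
  have hS : MeasurableSet S := by
    rw [hSdef]; simp only [ofPred_and]; exact (measurableSet_le (by fun_prop) (by fun_prop)).inter
      (measurableSet_lt (by fun_prop) (by fun_prop))
  have hW : ∀ z : ℝ × ℝ, z.1 < z.2 → volume (Prod.mk z ⁻¹' S) =
      1 * ENNReal.ofReal ((z.2 - z.1) ^ ((2 : ℝ) - 1)) := by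
    intro z _
    have : Prod.mk z ⁻¹' S = Ico z.1 z.2 := rfl
    have e : (2 : ℝ) - 1 = 1 := by norm_num
    rw [this, Real.volume_Ico, e, Real.rpow_one, one_mul]
  have hle : ∀ y : ℝ, P ((fun z => (z, y)) ⁻¹' S) = P' ((fun z => (z, y)) ⁻¹' S) := by
    intro y
    change P {z | z.1 ≤ y ∧ y < z.2} = P' {z | z.1 ≤ y ∧ y < z.2}
    rw [measure_le_lt_self H.lt_left, measure_le_lt_self H.lt_right,
      H.preimage_snd_eq measurableSet_Iic, H.preimage_fst_eq measurableSet_Iic]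
  exact le_antisymm
    (lintegral_le_of_section_le (W := volume) hS one_ne_zero ENNReal.one_ne_top
      (H.lt_left.mono hW) (H.lt_right.mono hW) fun y => (hle y).le)
    (lintegral_le_of_section_le (W := volume) hS one_ne_zero ENNReal.one_ne_top
      (H.lt_right.mono hW) (H.lt_left.mono hW) fun y => (hle y).ge)

lemma lintegral_rpow_anti [IsFiniteMeasure P] [IsFiniteMeasure P']
    (H : QuadrantLE P P') {p : ℝ} (hp : p ∈ Iic (1 : ℝ) ∪ Ici 2) :
    ∫⁻ z, ENNReal.ofReal ((z.2 - z.1) ^ (p - 1)) ∂P' ≤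
      ∫⁻ z, ENNReal.ofReal ((z.2 - z.1) ^ (p - 1)) ∂P := by
  rcases hp with hp | hp
  · rcases (mem_Iic.1 hp).eq_or_lt with rfl | h
    · exact H.lintegral_rpow_one_eq.ge
    · exact H.lintegral_rpow_le_of_lt_one h
  · rcases (mem_Ici.1 hp).eq_or_lt with rfl | h
    · exact H.lintegral_rpow_two_eq.ge
    · exact H.lintegral_rpow_le_of_two_lt h

lemma lintegral_rpow_mono [IsFiniteMeasure P] [IsFiniteMeasure P']
    (H : QuadrantLE P P') {p : ℝ} (hp : p ∈ Icc (1 : ℝ) 2) :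
    ∫⁻ z, ENNReal.ofReal ((z.2 - z.1) ^ (p - 1)) ∂P ≤
      ∫⁻ z, ENNReal.ofReal ((z.2 - z.1) ^ (p - 1)) ∂P' := by
  rcases hp.1.eq_or_lt with rfl | h1
  · exact H.lintegral_rpow_one_eq.le
  rcases hp.2.eq_or_lt with rfl | h2
  · exact H.lintegral_rpow_two_eq.le
  · exact H.lintegral_rpow_le_of_mem_Ioo h1 h2

end QuadrantLE

end Frechet

/-! ### Integration against a disintegrated density -/

section Kernel

variable {f : ℝ → ℝ} {c : ℝ}

instance : SFinite (scaledDensity f c) := by unfold scaledDensity; infer_instance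

lemma setLIntegral_mul_lintegral_kernel (hf : Measurable f) (hc : 0 < c) (κ : Kernel ℝ ℝ)
    [IsSFiniteKernel κ] {K : ℝ × ℝ → ℝ≥0∞} (hK : Measurable K) :
    ∫⁻ u in Ioo (0 : ℝ) 1, ENNReal.ofReal (f u) * ∫⁻ v, K (u, v) ∂κ u =
      ENNReal.ofReal c * ∫⁻ z, K z ∂((scaledDensity f c).compProd κ) := by
  rw [Measure.lintegral_compProd hK, scaledDensity,
    lintegral_withDensity_eq_lintegral_mul _ (by fun_prop) hK.lintegral_kernel_prod_right',
    ← lintegral_const_mul' _ _ ENNReal.ofReal_ne_top]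
  refine lintegral_congr fun u => ?_
  rw [Pi.mul_apply, ← mul_assoc, ← ENNReal.ofReal_mul hc.le, mul_div_cancel₀ _ hc.ne']

lemma ae_scaledDensity_iff (hf : Measurable f) (hc : 0 < c) {p : ℝ → Prop} :
    (∀ᵐ u ∂scaledDensity f c, p u) ↔ ∀ᵐ u ∂volume.restrict (Ioo (0 : ℝ) 1), 0 < f u → p u := by
  rw [scaledDensity, ae_withDensity_iff (by fun_prop)]
  simp only [ne_eq, ENNReal.ofReal_eq_zero, not_le, div_pos_iff_of_pos_right hc]

lemma ae_kernel_of_ae_compProd (hf : Measurable f) (hc : 0 < c) {κ : Kernel ℝ ℝ}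
    [IsSFiniteKernel κ] {p : ℝ × ℝ → Prop}
    (h : ∀ᵐ z ∂((scaledDensity f c).compProd κ), p z) :
    ∀ᵐ u ∂volume.restrict (Ioo (0 : ℝ) 1), 0 < f u → ∀ᵐ v ∂κ u, p (u, v) :=
  (ae_scaledDensity_iff hf hc).1 (Measure.ae_ae_of_ae_compProd h)

end Kernel

/-! ### The positive and negative parts of d, and the support of couplings in 𝒬 -/

section Marginals

variable {μ ν : Measure ℝ}

lemma posDiff_nonneg (u : ℝ) : 0 ≤ posDiff μ ν u := le_max_right _ _

lemma negDiff_nonneg (u : ℝ) : 0 ≤ negDiff μ ν u := le_max_right _ _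

lemma posDiff_pos_iff {u : ℝ} : 0 < posDiff μ ν u ↔ quantile ν u < quantile μ u := by
  simp [posDiff]

lemma negDiff_pos_iff {u : ℝ} : 0 < negDiff μ ν u ↔ quantile μ u < quantile ν u := by
  simp [negDiff]

lemma measurable_posDiff : Measurable (posDiff μ ν) :=
  ((measurable_quantile μ).sub (measurable_quantile ν)).max measurable_const

lemma measurable_negDiff : Measurable (negDiff μ ν) :=
  ((measurable_quantile μ).sub (measurable_quantile ν)).neg.max measurable_const

lemma marginalPlus_eq : marginalPlus μ ν = scaledDensity (posDiff μ ν) (gam μ ν) := rfl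

lemma marginalMinus_eq : marginalMinus μ ν = scaledDensity (negDiff μ ν) (gam μ ν) := rfl

/-- Since u < v and F_μ⁻¹ is monotone, F_ν⁻¹(u) < F_μ⁻¹(u) ≤ F_μ⁻¹(v) < F_ν⁻¹(v). This makes the
splitting weights positive and puts almost every u with d(u) ≠ 0 in one of the two regions of
`tildeKernel`. -/
lemma ae_of_mem_QSet (hγ : 0 < gam μ ν) {Q : Measure (ℝ × ℝ)} (hQ : Q ∈ QSet μ ν) :
    ∀ᵐ z ∂Q, (z.1 ∈ Ioo (0 : ℝ) 1 ∧ z.2 ∈ Ioo (0 : ℝ) 1) ∧ quantile ν z.1 < quantile μ z.1 ∧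
      quantile μ z.1 ≤ quantile μ z.2 ∧ quantile μ z.2 < quantile ν z.2 := by
  obtain ⟨hprob, h1, h2, h3⟩ := hQ
  have hS : MeasurableSet {z : ℝ × ℝ | z.1 ∈ Ioo (0 : ℝ) 1 ∧ z.2 ∈ Ioo (0 : ℝ) 1 ∧ z.1 < z.2} :=
    (measurable_fst measurableSet_Ioo).inter
      ((measurable_snd measurableSet_Ioo).inter (measurableSet_lt measurable_fst measurable_snd))
  have hae : ∀ᵐ z ∂Q, z.1 ∈ Ioo (0 : ℝ) 1 ∧ z.2 ∈ Ioo (0 : ℝ) 1 ∧ z.1 < z.2 :=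
    (prob_compl_eq_zero_iff hS).2 h3
  have hp : ∀ᵐ u ∂Q.map Prod.fst, quantile ν u < quantile μ u := by
    rw [h1, marginalPlus_eq, ae_scaledDensity_iff measurable_posDiff hγ]
    exact Filter.Eventually.of_forall fun u => posDiff_pos_iff.1
  have hm : ∀ᵐ u ∂Q.map Prod.snd, quantile μ u < quantile ν u := by
    rw [h2, marginalMinus_eq, ae_scaledDensity_iff measurable_negDiff hγ]
    exact Filter.Eventually.of_forall fun u => negDiff_pos_iff.1
  filter_upwards [hae, ae_of_ae_map measurable_fst.aemeasurable hp,
    ae_of_ae_map measurable_snd.aemeasurable hm] with z hz hz1 hz2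
  exact ⟨⟨hz.1, hz.2.1⟩, hz1, quantile_monotoneOn μ hz.1 hz.2.1 hz.2.2.le, hz2⟩

end Marginals

/-! ### The cost as an integral against Q -/

section Cost

variable {μ ν : Measure ℝ}

/-- The atom at F_ν⁻¹(u) is free. The mass |d(u)| / |F_ν⁻¹(v) - F_ν⁻¹(u)| sent to F_ν⁻¹(v) lowers
the exponent by one. Requiring a positive quotient covers both signs of d(u). -/
lemma lintegral_splitMeasure {π : Measure ℝ} {u ρ : ℝ}
    (h : ∀ᵐ v ∂π, v ∈ Ioo (0 : ℝ) 1 ∧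
      0 < (quantile μ u - quantile ν u) / (quantile ν v - quantile ν u)) :
    ∫⁻ y, ({y | y ≠ quantile ν u} : Set ℝ).indicator
      (fun y => ENNReal.ofReal (|quantile ν u - y| ^ ρ)) y ∂(splitMeasure μ ν π u) =
    ENNReal.ofReal |quantile μ u - quantile ν u| *
      ∫⁻ v, ENNReal.ofReal (|quantile ν v - quantile ν u| ^ (ρ - 1)) ∂π := by
  have hν := measurable_quantile ν
  have hg : Measurable (({y | y ≠ quantile ν u} : Set ℝ).indicator
      (fun y => ENNReal.ofReal (|quantile ν u - y| ^ ρ))) :=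
    Measurable.indicator (by fun_prop) (measurableSet_singleton _).compl
  have hgν : Measurable fun v => ({y | y ≠ quantile ν u} : Set ℝ).indicator
      (fun y => ENNReal.ofReal (|quantile ν u - y| ^ ρ)) (quantile ν v) := hg.comp hν
  have hres : π.restrict (Ioo 0 1) = π :=
    Measure.restrict_eq_self_of_ae_mem (h.mono fun v hv => hv.1)
  rw [splitMeasure, lintegral_add_measure, hres, lintegral_map hg hν, lintegral_smul_measure,
    lintegral_dirac' _ hg, lintegral_withDensity_eq_lintegral_mul _ (by fun_prop) hgν,
    ← lintegral_const_mul' _ _ ENNReal.ofReal_ne_top]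
  rw [indicator_of_notMem (by simp), smul_zero, add_zero]
  refine lintegral_congr_ae (h.mono fun v hv => ?_)
  -- Division by zero gives 0, which would contradict the positive quotient.
  have hne : quantile ν v - quantile ν u ≠ 0 := fun h0 => by simp [h0] at hv
  have hpos : 0 < |quantile ν v - quantile ν u| := abs_pos.2 hne
  simp only [Pi.mul_apply]
  rw [indicator_of_mem (by simpa [sub_eq_zero] using hne), ← ENNReal.ofReal_mul hv.2.le,
    ← ENNReal.ofReal_mul (abs_nonneg _)]
  congr 1
  rw [← abs_of_pos hv.2, abs_div, abs_sub_comm (quantile ν u) (quantile ν v),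
    Real.rpow_sub_one hpos.ne']
  ring

/-- The cost of `m̃^Q` is `2γ ∫ (F_ν⁻¹(v) - F_ν⁻¹(u))^(ρ-1) Q(du, dv)`. -/
lemma cost_tildeKernel (hγ : 0 < gam μ ν) {Q : Measure (ℝ × ℝ)} (hQ : Q ∈ QSet μ ν)
    (D : Disintegration μ ν Q) (ρ : ℝ) :
    cost ν ρ (tildeKernel D) = 2 * ENNReal.ofReal (gam μ ν) *
      ∫⁻ z, ENNReal.ofReal ((quantile ν z.2 - quantile ν z.1) ^ (ρ - 1)) ∂Q := by
  have hν := measurable_quantile ν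
  have hae := ae_of_mem_QSet hγ hQ
  -- The absolute value makes K symmetric, so the part d < 0, which disintegrates the swapped Q,
  -- yields the same integral; hence the factor 2.
  set K : ℝ × ℝ → ℝ≥0∞ := fun z => ENNReal.ofReal (|quantile ν z.2 - quantile ν z.1| ^ (ρ - 1))
    with hK
  have hKm : Measurable K := by fun_prop
  have hKabs : ∫⁻ z, ENNReal.ofReal ((quantile ν z.2 - quantile ν z.1) ^ (ρ - 1)) ∂Q =
      ∫⁻ z, K z ∂Q := lintegral_congr_ae (hae.mono fun z hz => by
    simp only [hK]
    rw [abs_of_pos]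
    linarith [hz.2.1, hz.2.2.1, hz.2.2.2])
  have hplus : ∫⁻ u in Ioo (0 : ℝ) 1,
      ENNReal.ofReal (posDiff μ ν u) * ∫⁻ v, K (u, v) ∂D.piPlus u =
      ENNReal.ofReal (gam μ ν) * ∫⁻ z, K z ∂Q := by
    rw [setLIntegral_mul_lintegral_kernel measurable_posDiff hγ D.piPlus hKm, ← marginalPlus_eq,
      ← D.eq_plus]
  have hminus : ∫⁻ u in Ioo (0 : ℝ) 1,
      ENNReal.ofReal (negDiff μ ν u) * ∫⁻ v, K (u, v) ∂D.piMinus u =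
      ENNReal.ofReal (gam μ ν) * ∫⁻ z, K z ∂Q := by
    rw [setLIntegral_mul_lintegral_kernel measurable_negDiff hγ D.piMinus hKm,
      ← marginalMinus_eq]
    conv_rhs => rw [D.eq_minus, lintegral_map hKm measurable_swap]
    simp only [hK, Prod.fst_swap, Prod.snd_swap]
    simp_rw [abs_sub_comm (quantile ν (Prod.snd _))]
  have haep : ∀ᵐ u ∂volume.restrict (Ioo (0 : ℝ) 1), 0 < posDiff μ ν u →
      ∀ᵐ v ∂D.piPlus u, v ∈ Ioo (0 : ℝ) 1 ∧ quantile μ u < quantile ν v := by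
    refine ae_kernel_of_ae_compProd (c := gam μ ν)
      (p := fun z => z.2 ∈ Ioo (0 : ℝ) 1 ∧ quantile μ z.1 < quantile ν z.2)
      measurable_posDiff hγ ?_
    rw [← marginalPlus_eq, ← D.eq_plus]
    exact hae.mono fun z hz => ⟨hz.1.2, hz.2.2.1.trans_lt hz.2.2.2⟩
  have haem : ∀ᵐ u ∂volume.restrict (Ioo (0 : ℝ) 1), 0 < negDiff μ ν u →
      ∀ᵐ v ∂D.piMinus u, v ∈ Ioo (0 : ℝ) 1 ∧ quantile ν v < quantile μ u := by
    refine ae_kernel_of_ae_compProd (c := gam μ ν)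
      (p := fun z => z.2 ∈ Ioo (0 : ℝ) 1 ∧ quantile ν z.2 < quantile μ z.1)
      measurable_negDiff hγ ?_
    rw [D.eq_minus] at hae
    rw [← marginalMinus_eq]
    exact (ae_of_ae_map measurable_swap.aemeasurable hae).mono fun z hz =>
      ⟨hz.1.1, hz.2.1.trans_le hz.2.2.1⟩
  have hinner : ∀ᵐ u ∂volume.restrict (Ioo (0 : ℝ) 1),
      ∫⁻ y, ({y | y ≠ quantile ν u} : Set ℝ).indicator
        (fun y => ENNReal.ofReal (|quantile ν u - y| ^ ρ)) y ∂(tildeKernel D u) =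
      ENNReal.ofReal (posDiff μ ν u) * ∫⁻ v, K (u, v) ∂D.piPlus u +
        ENNReal.ofReal (negDiff μ ν u) * ∫⁻ v, K (u, v) ∂D.piMinus u := by
    filter_upwards [haep, haem, D.piPlus_mass, D.piMinus_mass, ae_restrict_mem measurableSet_Ioo]
      with u hup hum hmp hmm hu
    classical
    change ∫⁻ y, _ ∂(if u ∈ regionPlus μ ν D.piPlus then splitMeasure μ ν (D.piPlus u) u
      else if u ∈ regionMinus μ ν D.piMinus then splitMeasure μ ν (D.piMinus u) u
      else Measure.dirac (quantile ν u)) = _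
    rcases lt_trichotomy (quantile ν u) (quantile μ u) with h | h | h
    · have hd := posDiff_pos_iff.2 h
      -- The kernel is only sub-Markov: the full mass comes from `piPlus_mass`, and its location
      -- from `haep`.
      have hmem : u ∈ regionPlus μ ν D.piPlus := by
        refine ⟨hu, h, ?_⟩
        rw [← hmp h]
        exact measure_congr ((hup hd).mono fun v hv => propext ⟨fun h => h.1, fun _ => hv⟩)
      have hn : negDiff μ ν u = 0 := max_eq_right (by linarith)
      have hp : posDiff μ ν u = quantile μ u - quantile ν u := max_eq_left (by linarith)
      rw [if_pos hmem, lintegral_splitMeasure, hn, ENNReal.ofReal_zero, zero_mul, add_zero, hp,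
        abs_of_pos (by linarith)]
      exact (hup hd).mono fun v hv => ⟨hv.1, div_pos (by linarith) (by linarith [hv.2])⟩
    · have hn : negDiff μ ν u = 0 := max_eq_right (by linarith)
      have hp : posDiff μ ν u = 0 := max_eq_right (by linarith)
      rw [if_neg fun hmem => hmem.2.1.ne h, if_neg fun hmem => hmem.2.1.ne' h, lintegral_dirac, hn,
        hp, indicator_of_notMem (by simp)]
      simp
    · have hd := negDiff_pos_iff.2 h
      have hmem : u ∈ regionMinus μ ν D.piMinus := by
        refine ⟨hu, h, ?_⟩
        rw [← hmm h]
        exact measure_congr ((hum hd).mono fun v hv => propext ⟨fun h => h.1, fun _ => hv⟩)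
      have hn : negDiff μ ν u = -(quantile μ u - quantile ν u) := max_eq_left (by linarith)
      have hp : posDiff μ ν u = 0 := max_eq_right (by linarith)
      rw [if_neg fun hmem => hmem.2.1.not_gt h, if_pos hmem, lintegral_splitMeasure, hp,
        ENNReal.ofReal_zero, zero_mul, zero_add, hn, abs_of_neg (by linarith)]
      exact (hum hd).mono fun v hv =>
        ⟨hv.1, div_pos_of_neg_of_neg (by linarith) (by linarith [hv.2])⟩
  have hmeas : Measurable fun u => ENNReal.ofReal (posDiff μ ν u) * ∫⁻ v, K (u, v) ∂D.piPlus u :=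
    (measurable_posDiff.ennreal_ofReal).mul hKm.lintegral_kernel_prod_right'
  rw [cost, lintegral_congr_ae hinner, lintegral_add_left hmeas, hplus, hminus, hKabs, two_mul,
    add_mul]

end Cost

/-! ### From ordered distribution functions to ordered costs -/

section Comparison

variable {μ ν : Measure ℝ}

/-- By `quantile_le_iff`, the quadrant with corner (s, r) pulls back to the one with corner (F_ν(s),
F_ν(r)), so the order of distribution functions survives the push-forward. -/
lemma quadrantLE_map_quantile (hγ : 0 < gam μ ν) {Q Q' : Measure (ℝ × ℝ)} (hQ : Q ∈ QSet μ ν)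
    (hQ' : Q' ∈ QSet μ ν) (h : ∀ a b, Q (Iic a ×ˢ Iic b) ≤ Q' (Iic a ×ˢ Iic b)) :
    QuadrantLE (Q.map (Prod.map (quantile ν) (quantile ν)))
      (Q'.map (Prod.map (quantile ν) (quantile ν))) := by
  have hν := measurable_quantile ν
  have hm : Measurable (Prod.map (quantile ν) (quantile ν)) := hν.prodMap hν
  have hfst : ∀ R ∈ QSet μ ν, (R.map (Prod.map (quantile ν) (quantile ν))).map Prod.fst =
      (marginalPlus μ ν).map (quantile ν) := fun R hR => by
    rw [Measure.map_map measurable_fst hm, ← hR.2.1, Measure.map_map hν measurable_fst]; rfl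
  have hsnd : ∀ R ∈ QSet μ ν, (R.map (Prod.map (quantile ν) (quantile ν))).map Prod.snd =
      (marginalMinus μ ν).map (quantile ν) := fun R hR => by
    rw [Measure.map_map measurable_snd hm, ← hR.2.2.1, Measure.map_map hν measurable_snd]; rfl
  have hlt : ∀ R ∈ QSet μ ν, ∀ᵐ z ∂(R.map (Prod.map (quantile ν) (quantile ν))), z.1 < z.2 :=
    fun R hR => (ae_map_iff hm.aemeasurable (measurableSet_lt measurable_fst measurable_snd)).2
      ((ae_of_mem_QSet hγ hR).mono fun z hz => hz.2.1.trans (hz.2.2.1.trans_lt hz.2.2.2))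
  have hIic : ∀ R ∈ QSet μ ν, ∀ s r, R.map (Prod.map (quantile ν) (quantile ν)) (Iic s ×ˢ Iic r) =
      R (Iic (cdf ν s) ×ˢ Iic (cdf ν r)) := fun R hR s r => by
    rw [Measure.map_apply hm (measurableSet_Iic.prod measurableSet_Iic)]
    refine measure_congr ((ae_of_mem_QSet hγ hR).mono fun z hz => propext ?_)
    exact and_congr (quantile_le_iff ν hz.1.1 s) (quantile_le_iff ν hz.1.2 r)
  exact ⟨by rw [hfst Q hQ, hfst Q' hQ'], by rw [hsnd Q hQ, hsnd Q' hQ'], hlt Q hQ, hlt Q' hQ',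
    fun s r => by rw [hIic Q hQ, hIic Q' hQ']; exact h _ _⟩

/-- Costs of couplings in `𝒬` compare according to their distribution functions. -/
lemma cost_comparison (hγ : 0 < gam μ ν) {Q Q' : Measure (ℝ × ℝ)} (hQ : Q ∈ QSet μ ν)
    (hQ' : Q' ∈ QSet μ ν) (h : ∀ a b, Q (Iic a ×ˢ Iic b) ≤ Q' (Iic a ×ˢ Iic b))
    (D : Disintegration μ ν Q) (D' : Disintegration μ ν Q') :
    (∀ ρ ∈ Iic (1 : ℝ) ∪ Ici 2, cost ν ρ (tildeKernel D') ≤ cost ν ρ (tildeKernel D)) ∧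
    (∀ ρ ∈ Icc (1 : ℝ) 2, cost ν ρ (tildeKernel D) ≤ cost ν ρ (tildeKernel D')) ∧
    (∀ ρ ∈ ({1, 2} : Set ℝ), cost ν ρ (tildeKernel D') = cost ν ρ (tildeKernel D)) := by
  have hν := measurable_quantile ν
  have hm : Measurable (Prod.map (quantile ν) (quantile ν)) := hν.prodMap hν
  have hprob := hQ.1
  have hprob' := hQ'.1
  have H := quadrantLE_map_quantile hγ hQ hQ' h
  have hcost : ∀ R (_ : R ∈ QSet μ ν) (E : Disintegration μ ν R) (ρ : ℝ),
      cost ν ρ (tildeKernel E) = 2 * ENNReal.ofReal (gam μ ν) *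
        ∫⁻ z, ENNReal.ofReal ((z.2 - z.1) ^ (ρ - 1))
          ∂(R.map (Prod.map (quantile ν) (quantile ν))) := fun R hR E ρ => by
    rw [cost_tildeKernel hγ hR E ρ, lintegral_map (by fun_prop) hm]
    rfl
  have h1 : ∀ ρ ∈ Iic (1 : ℝ) ∪ Ici 2, cost ν ρ (tildeKernel D') ≤ cost ν ρ (tildeKernel D) :=
    fun ρ hρ => by
      rw [hcost Q hQ, hcost Q' hQ']
      exact mul_le_mul_right (H.lintegral_rpow_anti hρ) _
  have h2 : ∀ ρ ∈ Icc (1 : ℝ) 2, cost ν ρ (tildeKernel D) ≤ cost ν ρ (tildeKernel D') :=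
    fun ρ hρ => by
      rw [hcost Q hQ, hcost Q' hQ']
      exact mul_le_mul_right (H.lintegral_rpow_mono hρ) _
  refine ⟨h1, h2, fun ρ hρ => ?_⟩
  rcases hρ with rfl | rfl
  · exact le_antisymm (h1 1 (Or.inl (mem_Iic.2 le_rfl))) (h2 1 ⟨le_rfl, one_le_two⟩)
  · exact le_antisymm (h1 2 (Or.inr (mem_Ici.2 le_rfl))) (h2 2 ⟨one_le_two, le_rfl⟩)

end Comparison

/-! ### Couplings carried by graphs and the Fréchet bounds -/

section Coupling

variable {μ ν : Measure ℝ}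

lemma marginalPlus_univ (hγ : 0 < gam μ ν) (hi : IntervalIntegrable (posDiff μ ν) volume 0 1) :
    marginalPlus μ ν univ = 1 := by
  rw [marginalPlus_eq, scaledDensity_univ posDiff_nonneg hi hγ]
  change ENNReal.ofReal (gam μ ν / gam μ ν) = 1
  rw [div_self hγ.ne', ENNReal.ofReal_one]

/-- That T takes values in (0,1) almost surely follows from its image law. -/
lemma map_prodMk_mem_QSet (hγ : 0 < gam μ ν) (hi : IntervalIntegrable (posDiff μ ν) volume 0 1)
    {T : ℝ → ℝ} (hT : AEMeasurable T (marginalPlus μ ν))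
    (hmap : (marginalPlus μ ν).map T = marginalMinus μ ν)
    (hlt : ∀ᵐ u ∂marginalPlus μ ν, u < T u) :
    (marginalPlus μ ν).map (fun u => (u, T u)) ∈ QSet μ ν := by
  have hprob : IsProbabilityMeasure (marginalPlus μ ν) := ⟨marginalPlus_univ hγ hi⟩
  have hg : AEMeasurable (fun u => (u, T u)) (marginalPlus μ ν) := aemeasurable_id.prodMk hT
  have hprob' := Measure.isProbabilityMeasure_map hg
  have hS : MeasurableSet {z : ℝ × ℝ | z.1 ∈ Ioo (0 : ℝ) 1 ∧ z.2 ∈ Ioo (0 : ℝ) 1 ∧ z.1 < z.2} :=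
    (measurable_fst measurableSet_Ioo).inter
      ((measurable_snd measurableSet_Ioo).inter (measurableSet_lt measurable_fst measurable_snd))
  have hTmem : ∀ᵐ u ∂marginalPlus μ ν, T u ∈ Ioo (0 : ℝ) 1 := by
    refine ae_of_ae_map hT ?_
    rw [hmap]
    exact ae_scaledDensity_mem_Ioo
  refine ⟨hprob', ?_, ?_, ?_⟩
  · rw [AEMeasurable.map_map_of_aemeasurable measurable_fst.aemeasurable hg]
    exact Measure.map_id
  · rw [AEMeasurable.map_map_of_aemeasurable measurable_snd.aemeasurable hg]
    exact hmap
  · refine (prob_compl_eq_zero_iff hS).1 ((ae_map_iff hg hS).2 ?_)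
    have hmem : ∀ᵐ u ∂marginalPlus μ ν, u ∈ Ioo (0 : ℝ) 1 := ae_scaledDensity_mem_Ioo
    filter_upwards [hmem, hTmem, hlt] with u h1 h2 h3
    exact ⟨h1, h2, h3⟩

lemma apply_fst_preimage_of_mem_QSet {Q : Measure (ℝ × ℝ)} (hQ : Q ∈ QSet μ ν) (a : ℝ) :
    Q (Prod.fst ⁻¹' Iic a) = marginalPlus μ ν (Iic a) := by
  rw [← hQ.2.1, Measure.map_apply measurable_fst measurableSet_Iic]

lemma apply_snd_preimage_of_mem_QSet {Q : Measure (ℝ × ℝ)} (hQ : Q ∈ QSet μ ν) (b : ℝ) :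
    Q (Prod.snd ⁻¹' Iic b) = marginalMinus μ ν (Iic b) := by
  rw [← hQ.2.2.1, Measure.map_apply measurable_snd measurableSet_Iic]

/-- A comonotone coupling has the largest distribution function. -/
lemma apply_prod_le_of_monotoneOn {T : ℝ → ℝ} (hT : AEMeasurable T (marginalPlus μ ν))
    (hmono : MonotoneOn T (Ioo 0 1))
    (hR : (marginalPlus μ ν).map (fun u => (u, T u)) ∈ QSet μ ν) {Q : Measure (ℝ × ℝ)}
    (hQ : Q ∈ QSet μ ν) (a b : ℝ) :
    Q (Iic a ×ˢ Iic b) ≤ (marginalPlus μ ν).map (fun u => (u, T u)) (Iic a ×ˢ Iic b) := by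
  set R := (marginalPlus μ ν).map (fun u => (u, T u)) with hRdef
  have hg : AEMeasurable (fun u => (u, T u)) (marginalPlus μ ν) := aemeasurable_id.prodMk hT
  have hmem : ∀ᵐ u ∂marginalPlus μ ν, u ∈ Ioo (0 : ℝ) 1 := ae_scaledDensity_mem_Ioo
  have happ : ∀ s : Set (ℝ × ℝ), MeasurableSet s →
      R s = marginalPlus μ ν ((fun u => (u, T u)) ⁻¹' s) := fun s hs =>
    Measure.map_apply_of_aemeasurable hg hs
  have hIJ : MeasurableSet (Iic a ×ˢ Iic b : Set (ℝ × ℝ)) :=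
    measurableSet_Iic.prod measurableSet_Iic
  -- Either {u ≤ a} is contained in {T u ≤ b} or, by monotonicity, the reverse inclusion holds. The
  -- quadrant then has the mass of one full marginal strip, the upper Fréchet bound.
  by_cases h : ∀ u ∈ Ioo (0 : ℝ) 1, u ≤ a → T u ≤ b
  · have e : R (Iic a ×ˢ Iic b) = R (Prod.fst ⁻¹' Iic a) := by
      rw [happ _ hIJ, happ _ (measurable_fst measurableSet_Iic)]
      exact measure_congr (hmem.mono fun u hu => propext ⟨fun h' => h'.1, fun h' => ⟨h', h u hu h'⟩⟩)
    rw [e, apply_fst_preimage_of_mem_QSet hR, ← apply_fst_preimage_of_mem_QSet hQ]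
    exact measure_mono fun z hz => hz.1
  · push Not at h
    obtain ⟨u₀, hu₀, hua, hub⟩ := h
    have e : R (Iic a ×ˢ Iic b) = R (Prod.snd ⁻¹' Iic b) := by
      rw [happ _ hIJ, happ _ (measurable_snd measurableSet_Iic)]
      refine measure_congr (hmem.mono fun u hu => propext ⟨fun h' => h'.2, fun h' => ⟨?_, h'⟩⟩)
      rcases le_total u u₀ with h1 | h1
      · exact h1.trans hua
      · exact absurd ((hmono hu₀ hu h1).trans h') (not_le.2 hub)
    rw [e, apply_snd_preimage_of_mem_QSet hR, ← apply_snd_preimage_of_mem_QSet hQ]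
    exact measure_mono fun z hz => hz.2

/-- A countermonotone coupling has the smallest distribution function. -/
lemma apply_prod_le_of_antitoneOn {T : ℝ → ℝ} (hT : AEMeasurable T (marginalPlus μ ν))
    (hanti : AntitoneOn T (Ioo 0 1))
    (hR : (marginalPlus μ ν).map (fun u => (u, T u)) ∈ QSet μ ν) {Q : Measure (ℝ × ℝ)}
    (hQ : Q ∈ QSet μ ν) (a b : ℝ) :
    (marginalPlus μ ν).map (fun u => (u, T u)) (Iic a ×ˢ Iic b) ≤ Q (Iic a ×ˢ Iic b) := by
  set R := (marginalPlus μ ν).map (fun u => (u, T u)) with hRdef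
  have hprob := hQ.1
  have hprob' := hR.1
  have hg : AEMeasurable (fun u => (u, T u)) (marginalPlus μ ν) := aemeasurable_id.prodMk hT
  have hmem : ∀ᵐ u ∂marginalPlus μ ν, u ∈ Ioo (0 : ℝ) 1 := ae_scaledDensity_mem_Ioo
  have hA : MeasurableSet (Prod.fst ⁻¹' Iic a : Set (ℝ × ℝ)) := measurable_fst measurableSet_Iic
  have hB : MeasurableSet (Prod.snd ⁻¹' Iic b : Set (ℝ × ℝ)) := measurable_snd measurableSet_Iic
  have happ : ∀ s : Set (ℝ × ℝ), MeasurableSet s →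
      R s = marginalPlus μ ν ((fun u => (u, T u)) ⁻¹' s) := fun s hs =>
    Measure.map_apply_of_aemeasurable hg hs
  -- Either the quadrant is null or, by antitonicity, the two strips cover everything. In the latter
  -- case inclusion-exclusion gives the lower Fréchet bound, the sum of the marginals minus 1.
  by_cases h : ∀ u ∈ Ioo (0 : ℝ) 1, u ≤ a → b < T u
  · have e : R (Iic a ×ˢ Iic b) = 0 := by
      rw [happ _ (measurableSet_Iic.prod measurableSet_Iic), ← measure_empty (μ := marginalPlus μ ν)]
      exact measure_congr (hmem.mono fun u hu =>
        propext ⟨fun h' => absurd h'.2 (not_le.2 (h u hu h'.1)), fun h' => h'.elim⟩)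
    rw [e]
    exact zero_le
  · push Not at h
    obtain ⟨u₀, hu₀, hua, hub⟩ := h
    have e : R (Prod.fst ⁻¹' Iic a ∪ Prod.snd ⁻¹' Iic b) = 1 := by
      rw [← measure_univ (μ := R), happ _ (hA.union hB), happ _ MeasurableSet.univ]
      refine measure_congr (hmem.mono fun u hu => propext ⟨fun _ => trivial, fun _ => ?_⟩)
      rcases le_total u u₀ with h1 | h1
      · exact Or.inl (h1.trans hua)
      · exact Or.inr ((hanti hu₀ hu h1).trans hub)
    have h1 := measure_union_add_inter (μ := R) (Prod.fst ⁻¹' Iic a) hB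
    have h2 := measure_union_add_inter (μ := Q) (Prod.fst ⁻¹' Iic a) hB
    rw [apply_fst_preimage_of_mem_QSet hR, apply_snd_preimage_of_mem_QSet hR,
      ← apply_fst_preimage_of_mem_QSet hQ, ← apply_snd_preimage_of_mem_QSet hQ, ← h2, e] at h1
    have h3 : 1 + R (Iic a ×ˢ Iic b) ≤ 1 + Q (Iic a ×ˢ Iic b) :=
      h1.le.trans (add_le_add_left prob_le_one _)
    exact (ENNReal.add_le_add_iff_left ENNReal.one_ne_top).1 h3

end Coupling

/-! ### Consequences of the convex order for d and γ -/

section Order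

variable {μ ν : Measure ℝ} [IsProbabilityMeasure μ] [IsProbabilityMeasure ν]

lemma intervalIntegrable_diff (hμ : Integrable (fun x : ℝ => x) μ)
    (hν : Integrable (fun x : ℝ => x) ν) :
    IntervalIntegrable (fun u => quantile μ u - quantile ν u) volume 0 1 :=
  (intervalIntegrable_quantile hμ).sub (intervalIntegrable_quantile hν)

lemma intervalIntegrable_posDiff (hμ : Integrable (fun x : ℝ => x) μ)
    (hν : Integrable (fun x : ℝ => x) ν) : IntervalIntegrable (posDiff μ ν) volume 0 1 := by
  have h := intervalIntegrable_diff hμ hν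
  rw [intervalIntegrable_iff_integrableOn_Ioc_of_le zero_le_one] at h ⊢
  exact h.pos_part

lemma intervalIntegrable_negDiff (hμ : Integrable (fun x : ℝ => x) μ)
    (hν : Integrable (fun x : ℝ => x) ν) : IntervalIntegrable (negDiff μ ν) volume 0 1 := by
  have h := intervalIntegrable_diff hμ hν
  rw [intervalIntegrable_iff_integrableOn_Ioc_of_le zero_le_one] at h ⊢
  exact h.neg_part

lemma PsiPlus_sub_PsiMinus (hμ : Integrable (fun x : ℝ => x) μ)
    (hν : Integrable (fun x : ℝ => x) ν) {u : ℝ} (hu : u ∈ Icc (0 : ℝ) 1) :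
    PsiPlus μ ν u - PsiMinus μ ν u = ∫ v in (0 : ℝ)..u, (quantile μ v - quantile ν v) := by
  have h0 : (0 : ℝ) ∈ Icc (0 : ℝ) 1 := ⟨le_rfl, zero_le_one⟩
  rw [PsiPlus, PsiMinus, ← intervalIntegral.integral_sub
    (intervalIntegrable_sub_of_mem (intervalIntegrable_posDiff hμ hν) h0 hu)
    (intervalIntegrable_sub_of_mem (intervalIntegrable_negDiff hμ hν) h0 hu)]
  congr 1
  ext v
  exact max_zero_sub_max_neg_zero_eq_self _

lemma integral_diff (hμ : Integrable (fun x : ℝ => x) μ)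
    (hν : Integrable (fun x : ℝ => x) ν) {u : ℝ} (hu : u ∈ Icc (0 : ℝ) 1) :
    ∫ v in (0 : ℝ)..u, (quantile μ v - quantile ν v) =
      (∫ v in (0 : ℝ)..u, quantile μ v) - ∫ v in (0 : ℝ)..u, quantile ν v := by
  have h0 : (0 : ℝ) ∈ Icc (0 : ℝ) 1 := ⟨le_rfl, zero_le_one⟩
  exact intervalIntegral.integral_sub
    (intervalIntegrable_sub_of_mem (intervalIntegrable_quantile hμ) h0 hu)
    (intervalIntegrable_sub_of_mem (intervalIntegrable_quantile hν) h0 hu)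

lemma StrictConvexOrder.PsiMinus_one (hμ : Integrable (fun x : ℝ => x) μ)
    (hν : Integrable (fun x : ℝ => x) ν) (hcx : StrictConvexOrder μ ν) :
    PsiMinus μ ν 1 = gam μ ν := by
  have h1 : (1 : ℝ) ∈ Icc (0 : ℝ) 1 := ⟨zero_le_one, le_rfl⟩
  have h := PsiPlus_sub_PsiMinus hμ hν h1
  rw [integral_diff hμ hν h1, hcx.integral_quantile_one_eq hν, sub_self, sub_eq_zero] at h
  exact h.symm

lemma StrictConvexOrder.integral_diff_nonneg (hμ : Integrable (fun x : ℝ => x) μ)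
    (hν : Integrable (fun x : ℝ => x) ν) (hcx : StrictConvexOrder μ ν) {u : ℝ}
    (hu : u ∈ Icc (0 : ℝ) 1) : 0 ≤ ∫ v in (0 : ℝ)..u, (quantile μ v - quantile ν v) := by
  rw [integral_diff hμ hν hu]
  exact sub_nonneg.2 (hcx.integral_quantile_le hμ hν hu)

/-- If γ = 0, both parts of d vanish almost everywhere, so the quantile functions agree almost
everywhere and push the uniform law to the same measure, against μ ≠ ν. -/
lemma StrictConvexOrder.gam_pos (hμ : Integrable (fun x : ℝ => x) μ)
    (hν : Integrable (fun x : ℝ => x) ν) (hcx : StrictConvexOrder μ ν) : 0 < gam μ ν := by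
  have hgam0 : 0 ≤ gam μ ν :=
    intervalIntegral.integral_nonneg zero_le_one fun u _ => posDiff_nonneg u
  refine lt_of_le_of_ne hgam0 fun h0 => hcx.2 ?_
  have hp := (intervalIntegral.integral_eq_zero_iff_of_le_of_nonneg_ae zero_le_one
    (Filter.Eventually.of_forall posDiff_nonneg) (intervalIntegrable_posDiff hμ hν)).1 h0.symm
  have hm := (intervalIntegral.integral_eq_zero_iff_of_le_of_nonneg_ae zero_le_one
    (Filter.Eventually.of_forall negDiff_nonneg) (intervalIntegrable_negDiff hμ hν)).1
    ((hcx.PsiMinus_one hμ hν).trans h0.symm)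
  rw [← map_quantile μ, ← map_quantile ν]
  refine Measure.map_congr ?_
  rw [restrict_Ioo_eq_restrict_Ioc]
  filter_upwards [hp, hm] with u h1 h2
  have h3 := max_zero_sub_max_neg_zero_eq_self (quantile μ u - quantile ν u)
  change posDiff μ ν u - negDiff μ ν u = _ at h3
  rw [h1, h2] at h3
  simp only [Pi.zero_apply] at h3
  linarith

/-- Almost everywhere on `{F_μ⁻¹ > F_ν⁻¹}`, the nonnegative primitive of `F_μ⁻¹ - F_ν⁻¹` is
positive: it cannot have a minimum where its derivative is positive. -/
lemma StrictConvexOrder.ae_integral_diff_pos (hμ : Integrable (fun x : ℝ => x) μ)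
    (hν : Integrable (fun x : ℝ => x) ν) (hcx : StrictConvexOrder μ ν) :
    ∀ᵐ u ∂marginalPlus μ ν, 0 < ∫ v in (0 : ℝ)..u, (quantile μ v - quantile ν v) := by
  rw [marginalPlus_eq, ae_scaledDensity_iff measurable_posDiff (hcx.gam_pos hμ hν)]
  filter_upwards [ae_restrict_of_ae (intervalIntegrable_diff hμ hν).ae_hasDerivAt_integral,
    ae_restrict_mem measurableSet_Ioo] with u hder hu hpos
  have hu' := Ioo_subset_Icc_self hu
  rw [uIcc_of_le (zero_le_one' ℝ)] at hder
  refine lt_of_le_of_ne (hcx.integral_diff_nonneg hμ hν hu') fun h0 => ?_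
  have hmin : IsLocalMin (fun x => ∫ v in (0 : ℝ)..x, (quantile μ v - quantile ν v)) u := by
    filter_upwards [Icc_mem_nhds hu.1 hu.2] with x hx
    rw [← h0]
    exact hcx.integral_diff_nonneg hμ hν hx
  have := hmin.hasDerivAt_eq_zero (hder hu' 0 ⟨le_rfl, zero_le_one⟩)
  linarith [posDiff_pos_iff.1 hpos]

end Order

/-! ### The inverse transform coupling -/

section InverseTransform

variable {μ ν : Measure ℝ} [IsProbabilityMeasure μ] [IsProbabilityMeasure ν]

lemma StrictConvexOrder.monotoneOn_phi (hμ : Integrable (fun x : ℝ => x) μ)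
    (hν : Integrable (fun x : ℝ => x) ν) (hcx : StrictConvexOrder μ ν) :
    MonotoneOn (phi μ ν) (Ioo 0 1) :=
  monotoneOn_level_primitive (g := PsiMinus μ ν) posDiff_nonneg (intervalIntegrable_posDiff hμ hν)
    (hcx.PsiMinus_one hμ hν)

lemma StrictConvexOrder.aemeasurable_phi (hμ : Integrable (fun x : ℝ => x) μ)
    (hν : Integrable (fun x : ℝ => x) ν) (hcx : StrictConvexOrder μ ν) :
    AEMeasurable (phi μ ν) (marginalPlus μ ν) :=
  aemeasurable_level_primitive (g := PsiMinus μ ν) posDiff_nonneg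
    (intervalIntegrable_posDiff hμ hν) (hcx.PsiMinus_one hμ hν)

lemma StrictConvexOrder.map_phi (hμ : Integrable (fun x : ℝ => x) μ)
    (hν : Integrable (fun x : ℝ => x) ν) (hcx : StrictConvexOrder μ ν) :
    (marginalPlus μ ν).map (phi μ ν) = marginalMinus μ ν :=
  map_level_primitive posDiff_nonneg (intervalIntegrable_posDiff hμ hν) negDiff_nonneg
    (intervalIntegrable_negDiff hμ hν) (hcx.gam_pos hμ hν) (hcx.PsiMinus_one hμ hν)

/-- By the Galois connection φ(u) ≤ u would give Ψ₊(u) ≤ Ψ₋(u), contradicting ∫₀ᵘ d > 0. -/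
lemma StrictConvexOrder.ae_lt_phi (hμ : Integrable (fun x : ℝ => x) μ)
    (hν : Integrable (fun x : ℝ => x) ν) (hcx : StrictConvexOrder μ ν) :
    ∀ᵐ u ∂marginalPlus μ ν, u < phi μ ν u := by
  have hmem : ∀ᵐ u ∂marginalPlus μ ν, u ∈ Ioo (0 : ℝ) 1 := ae_scaledDensity_mem_Ioo
  have hm := intervalIntegrable_negDiff hμ hν
  filter_upwards [hmem, hcx.ae_integral_diff_pos hμ hν] with u hu hpos
  have hu' := Ioo_subset_Icc_self hu
  rw [← PsiPlus_sub_PsiMinus hμ hν hu'] at hpos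
  by_contra h
  have h1 := (level_le_iff (g := PsiMinus μ ν) (y := PsiPlus μ ν u) (continuousOn_primitive hm)
    (monotoneOn_primitive negDiff_nonneg hm)
    (((hcx.PsiMinus_one hμ hν).symm ▸
      primitive_le_one posDiff_nonneg (intervalIntegrable_posDiff hμ hν) hu')) hu').1 (not_lt.1 h)
  linarith

/-- The indicator is harmless: the image law of φ is carried by (0,1). -/
lemma StrictConvexOrder.QIT_eq (hμ : Integrable (fun x : ℝ => x) μ)
    (hν : Integrable (fun x : ℝ => x) ν) (hcx : StrictConvexOrder μ ν) :
    QIT μ ν = (marginalPlus μ ν).map fun u => (u, phi μ ν u) := by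
  have h : ∀ᵐ u ∂marginalPlus μ ν, phi μ ν u ∈ Ioo (0 : ℝ) 1 := by
    refine ae_of_ae_map (hcx.aemeasurable_phi hμ hν) ?_
    rw [hcx.map_phi hμ hν]
    exact ae_scaledDensity_mem_Ioo
  have h' : ∀ᵐ u ∂marginalPlus μ ν, u ∈ {u | 0 < phi μ ν u ∧ phi μ ν u < 1} := h
  rw [QIT, Measure.restrict_eq_self_of_ae_mem h']

lemma StrictConvexOrder.QIT_mem (hμ : Integrable (fun x : ℝ => x) μ)
    (hν : Integrable (fun x : ℝ => x) ν) (hcx : StrictConvexOrder μ ν) : QIT μ ν ∈ QSet μ ν := by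
  rw [hcx.QIT_eq hμ hν]
  exact map_prodMk_mem_QSet (hcx.gam_pos hμ hν) (intervalIntegrable_posDiff hμ hν)
    (hcx.aemeasurable_phi hμ hν) (hcx.map_phi hμ hν) (hcx.ae_lt_phi hμ hν)

lemma StrictConvexOrder.apply_prod_le_QIT (hμ : Integrable (fun x : ℝ => x) μ)
    (hν : Integrable (fun x : ℝ => x) ν) (hcx : StrictConvexOrder μ ν) {Q : Measure (ℝ × ℝ)}
    (hQ : Q ∈ QSet μ ν) (a b : ℝ) : Q (Iic a ×ˢ Iic b) ≤ QIT μ ν (Iic a ×ˢ Iic b) := by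
  have h := hcx.QIT_mem hμ hν
  rw [hcx.QIT_eq hμ hν] at h ⊢
  exact apply_prod_le_of_monotoneOn (hcx.aemeasurable_phi hμ hν) (hcx.monotoneOn_phi hμ hν) h hQ a b

end InverseTransform

/-! ### The nonincreasing transform coupling -/

section NonincreasingTransform

variable {μ ν : Measure ℝ} [IsProbabilityMeasure μ] [IsProbabilityMeasure ν]

lemma StrictConvexOrder.chiMinus_one (hμ : Integrable (fun x : ℝ => x) μ)
    (hν : Integrable (fun x : ℝ => x) ν) (hcx : StrictConvexOrder μ ν) :
    chiMinus μ ν 1 = gam μ ν := by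
  rw [chiMinus, sub_self]
  exact hcx.PsiMinus_one hμ hν

lemma StrictConvexOrder.antitoneOn_one_sub_Gam (hμ : Integrable (fun x : ℝ => x) μ)
    (hν : Integrable (fun x : ℝ => x) ν) (hcx : StrictConvexOrder μ ν) :
    AntitoneOn (fun u => 1 - Gam μ ν u) (Ioo 0 1) := fun _ ha _ hb hab =>
  sub_le_sub_left (monotoneOn_level_primitive (g := chiMinus μ ν) posDiff_nonneg
    (intervalIntegrable_posDiff hμ hν) (hcx.chiMinus_one hμ hν) ha hb hab) 1

lemma StrictConvexOrder.aemeasurable_one_sub_Gam (hμ : Integrable (fun x : ℝ => x) μ)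
    (hν : Integrable (fun x : ℝ => x) ν) (hcx : StrictConvexOrder μ ν) :
    AEMeasurable (fun u => 1 - Gam μ ν u) (marginalPlus μ ν) :=
  (aemeasurable_level_primitive (g := chiMinus μ ν) posDiff_nonneg
    (intervalIntegrable_posDiff hμ hν) (hcx.chiMinus_one hμ hν)).const_sub 1

lemma StrictConvexOrder.map_one_sub_Gam (hμ : Integrable (fun x : ℝ => x) μ)
    (hν : Integrable (fun x : ℝ => x) ν) (hcx : StrictConvexOrder μ ν) :
    (marginalPlus μ ν).map (fun u => 1 - Gam μ ν u) = marginalMinus μ ν :=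
  map_one_sub_level_primitive posDiff_nonneg (intervalIntegrable_posDiff hμ hν) negDiff_nonneg
    (intervalIntegrable_negDiff hμ hν) (hcx.gam_pos hμ hν) (hcx.PsiMinus_one hμ hν)

/-- By Lebesgue differentiation d is almost everywhere the derivative of its primitive, so its sign
is read off from monotonicity on each side of p. -/
lemma ae_of_singleSignChange (hμ : Integrable (fun x : ℝ => x) μ)
    (hν : Integrable (fun x : ℝ => x) ν) {p : ℝ}
    (h1 : MonotoneOn (fun u => ∫ v in (0 : ℝ)..u, (quantile μ v - quantile ν v)) (Icc 0 p))
    (h2 : AntitoneOn (fun u => ∫ v in (0 : ℝ)..u, (quantile μ v - quantile ν v)) (Icc p 1)) :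
    ∀ᵐ u ∂volume.restrict (Ioo (0 : ℝ) 1), (quantile ν u < quantile μ u → u ≤ p) ∧
      (quantile μ u < quantile ν u → p ≤ u) := by
  filter_upwards [ae_restrict_of_ae (intervalIntegrable_diff hμ hν).ae_hasDerivAt_integral,
    ae_restrict_mem measurableSet_Ioo] with u hder hu
  have hu' := Ioo_subset_Icc_self hu
  rw [uIcc_of_le (zero_le_one' ℝ)] at hder
  have hd := hder hu' 0 ⟨le_rfl, zero_le_one⟩
  constructor
  · intro h
    by_contra! hp
    have hnhds : Icc p 1 ∈ nhds u := Icc_mem_nhds hp hu.2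
    have := (h2.derivWithin_nonpos (x := u))
    rw [derivWithin_of_mem_nhds hnhds, hd.deriv] at this
    linarith
  · intro h
    by_contra! hp
    have hnhds : Icc 0 p ∈ nhds u := Icc_mem_nhds hu.1 hp
    have := (h1.derivWithin_nonneg (x := u))
    rw [derivWithin_of_mem_nhds hnhds, hd.deriv] at this
    linarith

/-- The point p separates the two marginals: u lies below it, and 1 - Γ(u), distributed as the
second marginal, lies above it. -/
lemma StrictConvexOrder.ae_lt_one_sub_Gam (hμ : Integrable (fun x : ℝ => x) μ)
    (hν : Integrable (fun x : ℝ => x) ν) (hcx : StrictConvexOrder μ ν)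
    (hs : SingleSignChange μ ν) : ∀ᵐ u ∂marginalPlus μ ν, u < 1 - Gam μ ν u := by
  have hγ := hcx.gam_pos hμ hν
  obtain ⟨p, hp, h1, h2⟩ := hs
  have hae := ae_of_singleSignChange hμ hν h1 h2
  have hne : ∀ᵐ u : ℝ ∂volume.restrict (Ioo (0 : ℝ) 1), u ≠ p :=
    ae_restrict_of_ae (Measure.ae_ne volume p)
  have hplus : ∀ᵐ u ∂marginalPlus μ ν, u < p := by
    rw [marginalPlus_eq, ae_scaledDensity_iff measurable_posDiff hγ]
    filter_upwards [hae, hne] with u hu hup hpos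
    exact lt_of_le_of_ne (hu.1 (posDiff_pos_iff.1 hpos)) hup
  have hminus : ∀ᵐ u ∂marginalMinus μ ν, p < u := by
    rw [marginalMinus_eq, ae_scaledDensity_iff measurable_negDiff hγ]
    filter_upwards [hae, hne] with u hu hup hpos
    exact lt_of_le_of_ne (hu.2 (negDiff_pos_iff.1 hpos)) hup.symm
  rw [← hcx.map_one_sub_Gam hμ hν] at hminus
  filter_upwards [hplus, ae_of_ae_map (hcx.aemeasurable_one_sub_Gam hμ hν) hminus] with u hu hu'
  exact hu.trans hu'

lemma StrictConvexOrder.QNIT_eq (hμ : Integrable (fun x : ℝ => x) μ)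
    (hν : Integrable (fun x : ℝ => x) ν) (hcx : StrictConvexOrder μ ν) :
    QNIT μ ν = (marginalPlus μ ν).map fun u => (u, 1 - Gam μ ν u) := by
  have h : ∀ᵐ u ∂marginalPlus μ ν, 1 - Gam μ ν u ∈ Ioo (0 : ℝ) 1 := by
    refine ae_of_ae_map (hcx.aemeasurable_one_sub_Gam hμ hν) ?_
    rw [hcx.map_one_sub_Gam hμ hν]
    exact ae_scaledDensity_mem_Ioo
  have h' : ∀ᵐ u ∂marginalPlus μ ν, u ∈ {u | 0 < Gam μ ν u} :=
    h.mono fun u hu => by simpa using hu.2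
  rw [QNIT, Measure.restrict_eq_self_of_ae_mem h']

lemma StrictConvexOrder.QNIT_mem (hμ : Integrable (fun x : ℝ => x) μ)
    (hν : Integrable (fun x : ℝ => x) ν) (hcx : StrictConvexOrder μ ν)
    (hs : SingleSignChange μ ν) : QNIT μ ν ∈ QSet μ ν := by
  rw [hcx.QNIT_eq hμ hν]
  exact map_prodMk_mem_QSet (hcx.gam_pos hμ hν) (intervalIntegrable_posDiff hμ hν)
    (hcx.aemeasurable_one_sub_Gam hμ hν) (hcx.map_one_sub_Gam hμ hν)
    (hcx.ae_lt_one_sub_Gam hμ hν hs)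

lemma StrictConvexOrder.QNIT_apply_prod_le (hμ : Integrable (fun x : ℝ => x) μ)
    (hν : Integrable (fun x : ℝ => x) ν) (hcx : StrictConvexOrder μ ν)
    (hs : SingleSignChange μ ν) {Q : Measure (ℝ × ℝ)} (hQ : Q ∈ QSet μ ν) (a b : ℝ) :
    QNIT μ ν (Iic a ×ˢ Iic b) ≤ Q (Iic a ×ˢ Iic b) := by
  have h := hcx.QNIT_mem hμ hν hs
  rw [hcx.QNIT_eq hμ hν] at h ⊢
  exact apply_prod_le_of_antitoneOn (hcx.aemeasurable_one_sub_Gam hμ hν)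
    (hcx.antitoneOn_one_sub_Gam hμ hν) h hQ a b

end NonincreasingTransform

end ITMC

theorem mainTheorem8 (μ ν : Measure ℝ) [IsProbabilityMeasure μ] [IsProbabilityMeasure ν]
    (hμ : Integrable (fun x : ℝ => x) μ) (hν : Integrable (fun x : ℝ => x) ν)
    (hcx : ITMC.StrictConvexOrder μ ν) :
    (ITMC.QIT μ ν ∈ ITMC.QSet μ ν ∧
      ∀ Q ∈ ITMC.QSet μ ν, ∀ (D : ITMC.Disintegration μ ν Q)
        (DIT : ITMC.Disintegration μ ν (ITMC.QIT μ ν)),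
        (∀ ρ ∈ Iic (1 : ℝ) ∪ Ici 2,
          ITMC.cost ν ρ (ITMC.tildeKernel DIT) ≤ ITMC.cost ν ρ (ITMC.tildeKernel D)) ∧
        (∀ ρ ∈ Icc (1 : ℝ) 2,
          ITMC.cost ν ρ (ITMC.tildeKernel D) ≤ ITMC.cost ν ρ (ITMC.tildeKernel DIT)) ∧
        (∀ ρ ∈ ({1, 2} : Set ℝ),
          ITMC.cost ν ρ (ITMC.tildeKernel DIT) = ITMC.cost ν ρ (ITMC.tildeKernel D))) ∧
    (ITMC.SingleSignChange μ ν →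
      ITMC.QNIT μ ν ∈ ITMC.QSet μ ν ∧
      ∀ Q ∈ ITMC.QSet μ ν, ∀ (D : ITMC.Disintegration μ ν Q)
        (DNIT : ITMC.Disintegration μ ν (ITMC.QNIT μ ν)),
        (∀ ρ ∈ Iic (1 : ℝ) ∪ Ici 2,
          ITMC.cost ν ρ (ITMC.tildeKernel D) ≤ ITMC.cost ν ρ (ITMC.tildeKernel DNIT)) ∧
        (∀ ρ ∈ Icc (1 : ℝ) 2,
          ITMC.cost ν ρ (ITMC.tildeKernel DNIT) ≤ ITMC.cost ν ρ (ITMC.tildeKernel D)) ∧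
        (∀ ρ ∈ ({1, 2} : Set ℝ),
          ITMC.cost ν ρ (ITMC.tildeKernel DNIT) = ITMC.cost ν ρ (ITMC.tildeKernel D))) := by
  have hγ := hcx.gam_pos hμ hν
  refine ⟨⟨hcx.QIT_mem hμ hν, fun Q hQ D DIT => ?_⟩, fun hs =>
    ⟨hcx.QNIT_mem hμ hν hs, fun Q hQ D DNIT => ?_⟩⟩
  · exact ITMC.cost_comparison hγ hQ (hcx.QIT_mem hμ hν)
      (fun a b => hcx.apply_prod_le_QIT hμ hν hQ a b) D DIT
  -- `QNIT` has the smaller distribution function, so the two couplings exchange roles.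
  · obtain ⟨h1, h2, h3⟩ := ITMC.cost_comparison hγ (hcx.QNIT_mem hμ hν hs) hQ
      (fun a b => hcx.QNIT_apply_prod_le hμ hν hs hQ a b) DNIT D
    exact ⟨h1, h2, fun ρ hρ => (h3 ρ hρ).symm⟩
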